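/- **Setting.** Let $H$ be a (real or complex) Hilbert space, $T>0$, and let $A$ be a self-adjoint, densely defined (generally unbounded) operator in $H$ with $(Ax,x)\ge\alpha\|x\|^2$ for $x\in D(A)$, $\alpha>0$. Let $A=\sum_{j=1}^m A_j$ (with $D(A)=\bigcap_j D(A_j)$), where each $A_j$ is self-adjoint with $A_j\ge\alpha_j I$, $\alpha_j>0$. Let $M:H\to H$ satisfy $\|M(x)-M(y)\|\le a\|x-y\|$ for all $x,y\in H$, $a>0$, let $f:[0,T]\to H$ be continuous and $\varphi_0,\varphi_1\in H$. A solution of $$u''(t)+Au(t)+M(u(t))=f(t),\quad t\in[0,T],\qquad u(0)=\varphi_0,\quad u'(0)=\varphi_1, \tag{1}$$ is a twice continuously differentiable $u:[0,T]\to H$ with $u(t)\in D(A)$ for all $t$ and $Au$, $M(u)$ continuous, which satisfies (1). Let $n>1$, $\tau=T/n$, $t_k=k\tau$, let $0<\eta_j<1$ with $\sum_{j=1}^m\eta_j=1$, and let $v_0,\dots,v_n$ be given by $v_0=\varphi_0$, $v_1=\varphi_0+\tau\varphi_1$ and, for $k=1,\dots,n-1$, $v_{k+1}=\sum_{j=1}^m\eta_j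 y_{j,k+1}$, where $y_{j,k+1}\in D(A_j)$ solves $$\eta_j\frac{y_{j,k+1}-2v_k+v_{k-1}}{\tau^2}+A_jy_{j,k+1}=\delta_{1,j}\,[f(t_k)-M(v_k)],\qquad j=1,\dots,m.$$ Put $z_k=v_k-u(t_k)$, $\Delta z_k=z_{k+1}-z_k$, and $J_i(t,w)=\|w(t_i)-w(t)\|$. **Theorem.** Suppose that (1) has a solution $u$ and that $\varphi_0\in D(A)$. Then the operators $A_jA^{-1}$ are bounded and everywhere defined; put $a_j=\|A_jA^{-1}\|<\infty$. For $k=1,\dots,n-1$, $$\left\|\frac{\Delta z_k}{\tau}\right\|\le\left\|\frac{\Delta z_0}{\tau}\right\|+(\tau t_k)^{-1/2}\|z_0\|+\widetilde\Theta_k(\tau),$$ where $$\begin{aligned}\widetilde\Theta_k(\tau)={}&\tau\sum_{i=1}^k\bigl[c_5J_i(t_{i-1},u'')+J_i(t_{i+1},u'')+a\,c_6J_i(t_{i-1},u)\bigr]\\&+\tau\sum_{i=1}^k\bigl[c_7J_i(t_{i-1},f)+J_i(t_{i-1},f)\bigr]\\&+\sum_{i=1}^k\Bigl(\int_{t_{i-1}}^{t_{i+1}}J_i(t,u'')\,dt+\tau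 a\|z_i\|\Bigr)\\&+\tau\bigl[c_1\|A\varphi_0\|+c_6\bigl(\|f(0)\|+\|M(\varphi_0)\|\bigr)\bigr],\end{aligned}$$ and $$c_0=\sum_{j=1}^m\eta_j^{-1/2}a_j,\quad c_1=\sum_{j=1}^m\eta_j^{-3/2}(\eta_j^{-1}a_j+1),\quad c_4=\sum_{j=1}^m\eta_j^{-1}(\eta_j^{-1}a_j+1),$$ $$c_5=c_4+c_1,\quad c_6=\eta_1^{-1/2}+m+c_0,\quad c_7=c_4+c_1+c_6.$$ The same estimate also holds if the second summand $J_i(t_{i-1},f)$ in the second line of $\widetilde\Theta_k(\tau)$ is replaced by $J_i(t_{i+1},f)$. -/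

import Mathlib

open Set
open scoped BigOperators

noncomputable section

namespace HypScheme

section Operators

variable {𝕜 : Type*} [RCLike 𝕜] {H : Type*} [NormedAddCommGroup H] [InnerProductSpace 𝕜 H]

/-- The operator product `B A` of two (generally unbounded) operators, on its natural domain
`{x ∈ D(A) | A x ∈ D(B)}`. -/
def prod (B A : H →ₗ.[𝕜] H) : H →ₗ.[𝕜] H :=
  B.comp (A.domRestrict ((B.domain.comap A.toFun).map A.domain.subtype)) (by
    rintro ⟨x, hx⟩
    obtain ⟨⟨y, hy, rfl⟩, hx'⟩ := hx
    exact hy)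

/-- `T` is everywhere defined and bounded. -/
def IsBddEverywhere (T : H →ₗ.[𝕜] H) : Prop :=
  T.domain = ⊤ ∧ ∃ C : ℝ, ∀ x : T.domain, ‖T x‖ ≤ C * ‖(x : H)‖

/-- The operator norm of a bounded operator: the least constant `C ≥ 0` with `‖T x‖ ≤ C ‖x‖` on
the domain. -/
def opNorm (T : H →ₗ.[𝕜] H) : ℝ :=
  sInf {C : ℝ | 0 ≤ C ∧ ∀ x : T.domain, ‖T x‖ ≤ C * ‖(x : H)‖}

/-- `T` is self-adjoint (in particular densely defined) and `(T x, x) ≥ α ‖x‖²` on `D(T)`. -/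
structure IsSelfAdjointGE [CompleteSpace H] (T : H →ₗ.[𝕜] H) (α : ℝ) : Prop where
  dense : Dense (T.domain : Set H)
  selfAdjoint : IsSelfAdjoint T
  lowerBound : ∀ x : T.domain, α * ‖(x : H)‖ ^ 2 ≤ RCLike.re (inner 𝕜 (T x) (x : H))

end Operators

section Problem

variable {𝕜 : Type*} [RCLike 𝕜] {H : Type*} [NormedAddCommGroup H] [InnerProductSpace 𝕜 H]
  [NormedSpace ℝ H]

/-- The second derivative of `u` on `[0, T]` (one-sided at the end points). -/
def secondDeriv (T : ℝ) (u : ℝ → H) : ℝ → H :=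
  iteratedDerivWithin 2 u (Icc 0 T)

/-- `u` is a solution on `[0, T]` of `u'' + A u + M(u) = f`, `u(0) = φ₀`, `u'(0) = φ₁`. -/
structure IsSolution (A : H →ₗ.[𝕜] H) (M : H → H) (f : ℝ → H) (φ₀ φ₁ : H) (T : ℝ)
    (u : ℝ → H) : Prop where
  contDiffOn : ContDiffOn ℝ 2 u (Icc 0 T)
  mem_domain : ∀ t : Icc (0 : ℝ) T, u t ∈ A.domain
  continuous_A : Continuous fun t : Icc (0 : ℝ) T => A ⟨u t, mem_domain t⟩
  continuousOn_M : ContinuousOn (fun t => M (u t)) (Icc 0 T)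
  equation : ∀ t : Icc (0 : ℝ) T,
    secondDeriv T u t + A ⟨u t, mem_domain t⟩ + M (u t) = f t
  initial : u 0 = φ₀
  initial_deriv : derivWithin u (Icc 0 T) 0 = φ₁

/-- `v₀, …, vₙ` is the approximate solution given by the parallel decomposition scheme with step
`τ`, where `y (k + 1) j` is the solution of the `j`-th auxiliary problem at the point
`t_{k+1} = (k + 1) τ`, for `k = 1, …, n - 1`. The summands `A₁, …, A_m` and the weights are indexed
by `Fin m`, so the index `0` stands for the first summand. -/
structure IsApproxSolution {m : ℕ} [NeZero m] (A : Fin m → H →ₗ.[𝕜] H) (η : Fin m → ℝ)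
    (M : H → H) (f : ℝ → H) (φ₀ φ₁ : H) (τ : ℝ) (n : ℕ)
    (v : ℕ → H) (y : ℕ → Fin m → H) : Prop where
  start_zero : v 0 = φ₀
  start_one : v 1 = φ₀ + τ • φ₁
  mem_domain : ∀ k, 1 ≤ k → k + 1 ≤ n → ∀ j, y (k + 1) j ∈ (A j).domain
  auxiliary : ∀ (k : ℕ) (h1 : 1 ≤ k) (hn : k + 1 ≤ n) (j : Fin m),
    η j • ((τ ^ 2)⁻¹ • (y (k + 1) j - (2 : ℝ) • v k + v (k - 1)))
        + A j ⟨y (k + 1) j, mem_domain k h1 hn j⟩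
      = if j = 0 then f (k * τ) - M (v k) else 0
  average : ∀ k, 1 ≤ k → k + 1 ≤ n → v (k + 1) = ∑ j, η j • y (k + 1) j

end Problem

section Constants

/-- `c₀ = ∑ⱼ ηⱼ^{-1/2} aⱼ`. -/
def c₀ {m : ℕ} (η a' : Fin m → ℝ) : ℝ := ∑ j, η j ^ (-(1 / 2) : ℝ) * a' j

/-- `c₁ = ∑ⱼ ηⱼ^{-3/2} (ηⱼ⁻¹ aⱼ + 1)`. -/
def c₁ {m : ℕ} (η a' : Fin m → ℝ) : ℝ :=
  ∑ j, η j ^ (-(3 / 2) : ℝ) * ((η j)⁻¹ * a' j + 1)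

/-- `c₄ = ∑ⱼ ηⱼ⁻¹ (ηⱼ⁻¹ aⱼ + 1)`. -/
def c₄ {m : ℕ} (η a' : Fin m → ℝ) : ℝ := ∑ j, (η j)⁻¹ * ((η j)⁻¹ * a' j + 1)

def c₅ {m : ℕ} (η a' : Fin m → ℝ) : ℝ := c₄ η a' + c₁ η a'

/-- `c₆ = η₁^{-1/2} + m + c₀`. -/
def c₆ {m : ℕ} [NeZero m] (η a' : Fin m → ℝ) : ℝ :=
  η 0 ^ (-(1 / 2) : ℝ) + (m : ℝ) + c₀ η a'

def c₇ {m : ℕ} [NeZero m] (η a' : Fin m → ℝ) : ℝ := c₄ η a' + c₁ η a' + c₆ η a'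

end Constants

section Estimate

variable {H : Type*} [NormedAddCommGroup H]

/-- `J_i(t, w) = ‖w(t_i) - w(t)‖`, where `t_i = i τ`. -/
def J (τ : ℝ) (i : ℕ) (t : ℝ) (w : ℝ → H) : ℝ := ‖w (i * τ) - w t‖

/-- The error `z_k = v_k - u(t_k)`. -/
def err (τ : ℝ) (u : ℝ → H) (v : ℕ → H) (k : ℕ) : H := v k - u (k * τ)

/-- The quantity `Θ̃_k(τ)`. Here `u''` is the second derivative of `u`, `Aφ₀` and `Mφ₀` are the
vectors `A φ₀` and `M(φ₀)`, and the second summand with `f` is `J_i(t_{i+s}, f)`. -/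
def thetaTilde {m : ℕ} [NeZero m] (η a' : Fin m → ℝ) (a τ : ℝ) (u u'' f : ℝ → H) (v : ℕ → H)
    (Aφ₀ Mφ₀ : H) (s : ℝ) (k : ℕ) : ℝ :=
  τ * ∑ i ∈ Finset.Icc 1 k,
      (c₅ η a' * J τ i (((i : ℝ) - 1) * τ) u'' + J τ i (((i : ℝ) + 1) * τ) u''
        + a * c₆ η a' * J τ i (((i : ℝ) - 1) * τ) u)
  + τ * ∑ i ∈ Finset.Icc 1 k,
      (c₇ η a' * J τ i (((i : ℝ) - 1) * τ) f + J τ i (((i : ℝ) + s) * τ) f)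
  + ∑ i ∈ Finset.Icc 1 k,
      ((∫ t in (((i : ℝ) - 1) * τ)..(((i : ℝ) + 1) * τ), J τ i t u'') + τ * a * ‖err τ u v i‖)
  + τ * (c₁ η a' * ‖Aφ₀‖ + c₆ η a' * (‖f 0‖ + ‖Mφ₀‖))

end Estimate

end HypScheme

end

/-! Each auxiliary problem is solved by a scaled resolvent $L_j = d_j(d_j+A_j)^{-1}$,
$d_j=\eta_j/\tau^2$. The scheme is therefore one recursion
$v_{k+1}=S(2v_k-v_{k-1})+\tau^2L_0(f(t_k)-M(v_k))$ with $S=\sum_j\eta_jL_j$ self-adjoint and $0\le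
S\le 1$ (`IsApproxSolution.step`).

The exact solution satisfies $\eta_j(1-L_j)u=\tau^2L_jA_ju$. With $F=f-M(u)$, the residual in the
error recursion (`error_step`) is a Taylor and Lipschitz error minus $\tau^2$ times
$(1-L_0)F-\sum_j(1-L_j)A_ju+\sum_jL_j\Delta(A_ju)$. The terms with $1-L_j$ are not small: added up
over all steps they would only give a bounded contribution to $\Delta z_k/\tau$. Summation by parts
(`norm_increment_le`) replaces them by their time increments. The cost is that operators
$V_k(1-L_j)$ appear beside $V_{k+1}-V_k$, where $V_k$ is the fundamental solution.

Both are controlled by one nonincreasing discrete energy (`IsContrPos.energy_step_le`). It gives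
$\|V_{k+1}-V_k\|\le1$ and bounds the form of $1-S$ at $V_kx$ by $\|x\|^2$. Since $\eta_j(1-L_j)\le
1-S$, it follows that $\|V_k(1-L_j)\|\le\eta_j^{-1/2}$ (`IsDefectBounded.norm_comp_le`).

Finally $\|A_jx\|\le a_j\|Ax\|$, by the closed graph theorem, and $A\Delta u=\Delta F-\Delta u''$
turn all increments into the quantities $J_i$. The constants obtained are at most the stated ones,
and $z_0=0$. -/

noncomputable section

namespace HypScheme

/-! ### Resolvents of positive definite operators and boundedness of $BA^{-1}$ -/

section Operators

variable {𝕜 : Type*} [RCLike 𝕜] {H : Type*} [NormedAddCommGroup H] [InnerProductSpace 𝕜 H]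

variable {T : H →ₗ.[𝕜] H} {α : ℝ}

/-- `d x + T x` as a linear map on the domain of `T`. -/
def shift (T : H →ₗ.[𝕜] H) (d : ℝ) : T.domain →ₗ[𝕜] H :=
  (d : 𝕜) • T.domain.subtype + T.toFun

theorem shift_apply (d : ℝ) (x : T.domain) : shift T d x = (d : 𝕜) • (x : H) + T x := rfl

theorem mem_domain_sum {ι : Type*} (s : Finset ι) (B : ι → H →ₗ.[𝕜] H) {x : H} :
    x ∈ (∑ j ∈ s, B j).domain ↔ ∀ j ∈ s, x ∈ (B j).domain := by
  classical
  induction s using Finset.induction_on with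
  | empty => simp
  | insert i s hi ih =>
    rw [Finset.sum_insert hi, LinearPMap.add_domain, Submodule.mem_inf, ih]
    simp

theorem sum_apply_of_mem {ι : Type*} (s : Finset ι) (B : ι → H →ₗ.[𝕜] H) (b : ι → H) {x : H}
    (hx : x ∈ (∑ j ∈ s, B j).domain) (hb : ∀ j ∈ s, ∀ h : x ∈ (B j).domain, B j ⟨x, h⟩ = b j) :
    (∑ j ∈ s, B j) ⟨x, hx⟩ = ∑ j ∈ s, b j := by
  classical
  induction s using Finset.induction_on with
  | empty => simp [LinearPMap.zero_apply]
  | insert i s hi ih =>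
    have key : ∀ (C : H →ₗ.[𝕜] H) (hC : C = B i + ∑ j ∈ s, B j) (hx' : x ∈ C.domain),
        C ⟨x, hx'⟩ = b i + ∑ j ∈ s, b j := by
      rintro _ rfl hx'
      rw [LinearPMap.add_apply, hb i (Finset.mem_insert_self _ _),
        ih _ fun j hj => hb j (Finset.mem_insert_of_mem hj)]
    rw [Finset.sum_insert (f := b) hi]
    exact key _ (Finset.sum_insert hi) hx

theorem opNorm_nonneg (B : H →ₗ.[𝕜] H) : 0 ≤ opNorm B := Real.sInf_nonneg fun _ h => h.1

variable [CompleteSpace H]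

theorem IsSelfAdjointGE.isFormalAdjoint (hT : IsSelfAdjointGE T α) : T.IsFormalAdjoint T := by
  have h := LinearPMap.adjoint_isFormalAdjoint hT.dense
  rwa [LinearPMap.isSelfAdjoint_def.1 hT.selfAdjoint] at h

theorem IsSelfAdjointGE.re_inner_shift (hT : IsSelfAdjointGE T α) (d : ℝ) (x : T.domain) :
    (d + α) * ‖(x : H)‖ ^ 2 ≤ RCLike.re (inner 𝕜 (shift T d x) (x : H)) := by
  have h1 := hT.lowerBound x
  have h2 : RCLike.re (inner 𝕜 ((d : 𝕜) • (x : H)) (x : H)) = d * ‖(x : H)‖ ^ 2 := by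
    rw [inner_smul_left, inner_self_eq_norm_sq_to_K, RCLike.conj_ofReal, RCLike.re_ofReal_mul,
      ← RCLike.ofReal_pow, RCLike.ofReal_re]
  rw [shift_apply, inner_add_left, map_add, h2]
  linarith

theorem IsSelfAdjointGE.norm_le_shift (hT : IsSelfAdjointGE T α) {d : ℝ} (hd : 0 ≤ d)
    (x : T.domain) : α * ‖(x : H)‖ ≤ ‖shift T d x‖ := by
  have h1 := hT.re_inner_shift d x
  have h2 : RCLike.re (inner 𝕜 (shift T d x) (x : H)) ≤ ‖shift T d x‖ * ‖(x : H)‖ :=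
    (RCLike.re_le_norm _).trans (norm_inner_le_norm _ _)
  rcases (norm_nonneg (x : H)).eq_or_lt with h | h
  · rw [← h]; simp
  · have : 0 ≤ d * ‖(x : H)‖ ^ 2 := by positivity
    nlinarith

/-- A self-adjoint operator is closed, so its graph is complete. The range is the image of the graph
under $(p,q)\mapsto dp+q$, which is bounded below there in the graph norm. -/
theorem IsSelfAdjointGE.isClosed_range_shift (hT : IsSelfAdjointGE T α) (hα : 0 < α) {d : ℝ}
    (hd : 0 ≤ d) : IsClosed (LinearMap.range (shift T d) : Set H) := by
  have hc : IsClosed (T.graph : Set (H × H)) := hT.selfAdjoint.isClosed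
  have : CompleteSpace T.graph := hc.completeSpace_coe
  let g : T.graph →L[𝕜] H :=
    ((d : 𝕜) • ContinuousLinearMap.fst 𝕜 H H + ContinuousLinearMap.snd 𝕜 H H).comp
      T.graph.subtypeL
  have hg : ∀ p : T.graph, ∃ x : T.domain, (p : H × H) = ((x : H), T x) ∧ g p = shift T d x := by
    rintro ⟨⟨p, q⟩, hp⟩
    obtain ⟨x, rfl, rfl⟩ := (LinearPMap.mem_graph_iff T).1 hp
    exact ⟨x, rfl, rfl⟩
  have hr : (LinearMap.range (shift T d) : Set H) = Set.range g := by
    ext z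
    constructor
    · rintro ⟨x, rfl⟩
      exact ⟨⟨((x : H), T x), LinearPMap.mem_graph T x⟩, rfl⟩
    · rintro ⟨p, rfl⟩
      obtain ⟨x, -, hx⟩ := hg p
      exact ⟨x, hx.symm⟩
  rw [hr]
  -- The constant adds the bounds $\|x\|\le\alpha^{-1}\|(d+T)x\|$ and
  -- $\|Tx\|\le(1+d\alpha^{-1})\|(d+T)x\|$.
  refine AntilipschitzWith.isClosed_range (K := Real.toNNReal (α⁻¹ + (1 + d * α⁻¹))) ?_
    g.uniformContinuous
  refine AddMonoidHomClass.antilipschitz_of_bound g fun p => ?_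
  rw [Real.coe_toNNReal _ (by positivity)]
  obtain ⟨x, hp, hx⟩ := hg p
  have h1 : ‖(x : H)‖ ≤ α⁻¹ * ‖shift T d x‖ := by
    rw [inv_mul_eq_div, le_div_iff₀ hα, mul_comm]
    exact hT.norm_le_shift hd x
  have h2 : ‖T x‖ ≤ (1 + d * α⁻¹) * ‖shift T d x‖ := by
    have h3 : T x = shift T d x - (d : 𝕜) • (x : H) := by rw [shift_apply]; abel
    have h4 : ‖(d : 𝕜) • (x : H)‖ = d * ‖(x : H)‖ := by
      rw [norm_smul, RCLike.norm_ofReal, abs_of_nonneg hd]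
    have h5 := norm_sub_le (shift T d x) ((d : 𝕜) • (x : H))
    rw [← h3, h4] at h5
    have := mul_le_mul_of_nonneg_left h1 hd
    linarith
  have h3 : ‖p‖ = max ‖(x : H)‖ ‖T x‖ := by
    change ‖(p : H × H)‖ = max ‖(x : H)‖ ‖T x‖
    rw [hp, Prod.norm_def]
  rw [h3, hx]
  have h4 : 0 ≤ α⁻¹ * ‖shift T d x‖ := by positivity
  have h5 : 0 ≤ (1 + d * α⁻¹) * ‖shift T d x‖ := by positivity
  rw [add_mul α⁻¹]
  exact max_le (by linarith) (by linarith)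

/-- If $z$ is orthogonal to the range, then $(z,Tx)=(-dz,x)$ on $D(T)$, so $z\in D(T^*)=D(T)$.
Pairing $z$ with $(d+T)z$ then gives $(d+\alpha)\|z\|^2\le0$. -/
theorem IsSelfAdjointGE.range_shift (hT : IsSelfAdjointGE T α) (hα : 0 < α) {d : ℝ}
    (hd : 0 ≤ d) : LinearMap.range (shift T d) = ⊤ := by
  have : CompleteSpace (LinearMap.range (shift T d)) :=
    (hT.isClosed_range_shift hα hd).completeSpace_coe
  rw [← Submodule.orthogonal_eq_bot_iff, Submodule.eq_bot_iff]
  intro z hz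
  rw [Submodule.mem_orthogonal'] at hz
  have h1 : ∀ x : T.domain, inner 𝕜 (-((d : 𝕜) • z)) (x : H) = inner 𝕜 z (T x) := by
    intro x
    have := hz _ ⟨x, rfl⟩
    rw [shift_apply, inner_add_right, inner_smul_right] at this
    rw [inner_neg_left, inner_smul_left, RCLike.conj_ofReal]
    linear_combination -this
  have h2 : z ∈ T.domain := by
    rw [← LinearPMap.isSelfAdjoint_def.1 hT.selfAdjoint]
    exact LinearPMap.mem_adjoint_domain_of_exists z ⟨_, h1⟩
  have h3 := hz _ ⟨⟨z, h2⟩, rfl⟩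
  have h4 := hT.re_inner_shift d ⟨z, h2⟩
  rw [← inner_conj_symm, h3] at h4
  have h5 : ‖z‖ ^ 2 ≤ 0 := by
    simp only [map_zero] at h4
    by_contra h
    push Not at h
    have : 0 < (d + α) * ‖z‖ ^ 2 := by positivity
    exact absurd h4 (not_le.2 this)
  have h6 : ‖z‖ = 0 := by nlinarith [norm_nonneg z]
  exact norm_eq_zero.1 h6

/-- For `T` self-adjoint and positive definite and `d ≥ 0`, the operator `d + T` has an everywhere
defined bounded inverse. -/
theorem IsSelfAdjointGE.exists_inverse_shift (hT : IsSelfAdjointGE T α) (hα : 0 < α) {d : ℝ}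
    (hd : 0 ≤ d) : ∃ R : H →L[𝕜] H,
      (∀ x : T.domain, R (shift T d x) = x) ∧
      ∀ z, ∃ x : T.domain, (x : H) = R z ∧ shift T d x = z := by
  have hinj : Function.Injective (shift T d) := by
    rw [← LinearMap.ker_eq_bot, LinearMap.ker_eq_bot']
    intro x hx
    have := hT.norm_le_shift hd x
    rw [hx, norm_zero] at this
    have h6 : ‖(x : H)‖ = 0 := by nlinarith [norm_nonneg (x : H)]
    exact Subtype.ext (norm_eq_zero.1 h6)
  let e := LinearEquiv.ofBijective (shift T d)
    ⟨hinj, LinearMap.range_eq_top.1 (hT.range_shift hα hd)⟩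
  have he : ∀ x, e x = shift T d x := fun x => rfl
  refine ⟨(T.domain.subtype ∘ₗ e.symm.toLinearMap).mkContinuous α⁻¹ fun z => ?_, fun x => ?_,
    fun z => ⟨e.symm z, rfl, ?_⟩⟩
  · rw [inv_mul_eq_div, le_div_iff₀ hα, mul_comm]
    have := hT.norm_le_shift hd (e.symm z)
    rwa [← he, e.apply_symm_apply] at this
  · change ((e.symm (shift T d x) : T.domain) : H) = x
    rw [← he, e.symm_apply_apply]
  · rw [← he, e.apply_symm_apply]

/-- A self-adjoint operator `L` with `‖L x‖² ≤ (L x, x)`, that is `0 ≤ L ≤ 1`. -/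
structure IsFirm (L : H →L[𝕜] H) : Prop where
  selfAdjoint : IsSelfAdjoint L
  norm_sq_le : ∀ x, ‖L x‖ ^ 2 ≤ RCLike.re (inner 𝕜 (L x) x)

/-- The scaled resolvent `d (d + T)⁻¹`. -/
theorem IsSelfAdjointGE.exists_resolvent (hT : IsSelfAdjointGE T α) (hα : 0 < α) {d : ℝ}
    (hd : 0 < d) : ∃ L : H →L[𝕜] H, IsFirm L ∧
      ∀ x : T.domain, L ((d : 𝕜) • (x : H) + T x) = (d : 𝕜) • (x : H) := by
  obtain ⟨R, hR1, hR2⟩ := hT.exists_inverse_shift hα hd.le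
  have hsymm : ∀ x y, inner 𝕜 (R x) y = inner 𝕜 x (R y) := by
    intro x y
    obtain ⟨x', hx', rfl⟩ := hR2 x
    obtain ⟨y', hy', rfl⟩ := hR2 y
    rw [← hx', ← hy', shift_apply, shift_apply, inner_add_left, inner_add_right,
      hT.isFormalAdjoint x' y', inner_smul_left, inner_smul_right, RCLike.conj_ofReal]
  refine ⟨(d : 𝕜) • R, ⟨?_, fun x => ?_⟩, fun x => ?_⟩
  · rw [ContinuousLinearMap.isSelfAdjoint_iff_isSymmetric]
    intro x y
    simp only [ContinuousLinearMap.coe_coe, smul_apply]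
    rw [inner_smul_left, inner_smul_right, RCLike.conj_ofReal, hsymm]
  · obtain ⟨x', hx', rfl⟩ := hR2 x
    have h := hT.re_inner_shift d x'
    simp only [smul_apply]
    rw [inner_smul_left, RCLike.conj_ofReal, RCLike.re_ofReal_mul, norm_smul, RCLike.norm_ofReal,
      abs_of_pos hd, hsymm, ← hx', mul_pow, pow_two d, mul_assoc]
    refine mul_le_mul_of_nonneg_left ?_ hd.le
    have : 0 ≤ α * ‖(x' : H)‖ ^ 2 := by positivity
    linarith
  · rw [smul_apply]
    congr 1
    exact hR1 x

/-- If `D(A) ⊆ D(B)` for `B` closed and `A` self-adjoint positive definite, then `B A⁻¹` is bounded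
and everywhere defined. -/
theorem IsSelfAdjointGE.isBddEverywhere_prod_inverse (hT : IsSelfAdjointGE T α) (hα : 0 < α)
    {B : H →ₗ.[𝕜] H} (hB : B.IsClosed) (hle : T.domain ≤ B.domain) :
    IsBddEverywhere (prod B T.inverse) ∧
      ∀ x : T.domain, ‖B ⟨x, hle x.2⟩‖ ≤ opNorm (prod B T.inverse) * ‖T x‖ := by
  obtain ⟨R, hR1, hR2⟩ := hT.exists_inverse_shift hα le_rfl
  have hs : ∀ x : T.domain, shift T 0 x = T x := fun x => by simp [shift_apply]
  simp only [hs] at hR1 hR2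
  have hker : LinearMap.ker T.toFun = ⊥ := by
    rw [LinearMap.ker_eq_bot']
    intro x hx
    have h := hR1 x
    rw [show T x = 0 from hx, map_zero] at h
    exact Subtype.ext h.symm
  have hRT : ∀ z, R z ∈ T.domain := fun z => by
    obtain ⟨x, hx, -⟩ := hR2 z
    exact hx ▸ x.2
  have hTR : ∀ z, T ⟨R z, hRT z⟩ = z := fun z => by
    obtain ⟨x, hx, h⟩ := hR2 z
    have : (⟨R z, hRT z⟩ : T.domain) = x := Subtype.ext hx.symm
    rw [this, h]
  have hinvdom : ∀ z, z ∈ T.inverse.domain := fun z => by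
    rw [LinearPMap.inverse_domain]
    exact ⟨⟨R z, hRT z⟩, hTR z⟩
  have hinv : ∀ z (hz : z ∈ T.inverse.domain), T.inverse ⟨z, hz⟩ = R z := fun z hz =>
    LinearPMap.inverse_apply_eq hker (y := ⟨z, hz⟩) (x := ⟨R z, hRT z⟩) (hTR z)
  have hdom : ∀ z, z ∈ (prod B T.inverse).domain := fun z => by
    refine ⟨⟨⟨z, hinvdom z⟩, ?_, rfl⟩, hinvdom z⟩
    change T.inverse ⟨z, hinvdom z⟩ ∈ B.domain
    rw [hinv]
    exact hle (hRT z)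
  have happly : ∀ z : (prod B T.inverse).domain,
      prod B T.inverse z = B ⟨R z, hle (hRT z)⟩ := fun z => by
    obtain ⟨z, hz⟩ := z
    change B ⟨T.inverse ⟨z, hz.2⟩, _⟩ = _
    congr 1
    exact Subtype.ext (hinv z hz.2)
  let G : H →ₗ[𝕜] H := B.toFun ∘ₗ R.toLinearMap.codRestrict B.domain fun z => hle (hRT z)
  have hG : ∀ z, G z = B ⟨R z, hle (hRT z)⟩ := fun z => rfl
  have hGc : Continuous G := by
    refine G.continuous_of_isClosed_graph ?_
    -- Closed graph theorem: the graph of $BR$ is the preimage of the closed graph of $B$ under the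
    -- continuous map $(p,q)\mapsto(Rp,q)$.
    have : (G.graph : Set (H × H)) = (fun p : H × H => (R p.1, p.2)) ⁻¹' (B.graph : Set _) := by
      ext ⟨p, q⟩
      simp only [SetLike.mem_coe, LinearMap.mem_graph_iff, Set.mem_preimage,
        LinearPMap.mem_graph_iff]
      constructor
      · rintro rfl
        exact ⟨⟨R p, hle (hRT p)⟩, rfl, rfl⟩
      · rintro ⟨y, hy, rfl⟩
        rw [hG]
        congr 1
        exact Subtype.ext hy
    rw [this]
    have hB' : IsClosed (B.graph : Set (H × H)) := hB
    exact hB'.preimage (by fun_prop)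
  let G' : H →L[𝕜] H := ⟨G, hGc⟩
  have hbd : ∀ z : (prod B T.inverse).domain, ‖prod B T.inverse z‖ ≤ ‖G'‖ * ‖(z : H)‖ := fun z => by
    rw [happly, ← hG]
    exact G'.le_opNorm z
  refine ⟨⟨Submodule.eq_top_iff'.2 hdom, ‖G'‖, hbd⟩, fun x => ?_⟩
  have hx : B ⟨x, hle x.2⟩ = prod B T.inverse ⟨T x, hdom _⟩ := by
    rw [happly]
    congr 1
    exact Subtype.ext (hR1 x).symm
  rw [hx]
  have hne : Set.Nonempty {C : ℝ | 0 ≤ C ∧ ∀ x : (prod B T.inverse).domain,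
      ‖prod B T.inverse x‖ ≤ C * ‖(x : H)‖} := ⟨‖G'‖, norm_nonneg _, hbd⟩
  rcases (norm_nonneg (T x)).eq_or_lt with h0 | h0
  · have := hbd ⟨T x, hdom _⟩
    rw [← h0] at this ⊢
    simpa using this
  · rw [← div_le_iff₀ h0]
    refine le_csInf hne fun C hC => ?_
    rw [div_le_iff₀ h0]
    exact hC.2 ⟨T x, hdom _⟩

end Operators

/-! ### The recursion $w_2=S(2w_1-w_0)$: fundamental solution and energy -/

section Recursion

variable {𝕜 : Type*} [RCLike 𝕜] {H : Type*} [NormedAddCommGroup H] [InnerProductSpace 𝕜 H]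

variable {S L : H →L[𝕜] H}

/-- The fundamental solution of the recursion `w₂ = S (2 w₁ - w₀)`. -/
def fundSol (S : H →L[𝕜] H) : ℕ → (H →L[𝕜] H)
  | 0 => 0
  | 1 => 1
  | k + 2 => S * (fundSol S (k + 1) + (fundSol S (k + 1) - fundSol S k))

theorem fundSol_add_two (k : ℕ) :
    fundSol S (k + 2) = S * (fundSol S (k + 1) + (fundSol S (k + 1) - fundSol S k)) := rfl

/-- Summation by parts. -/
theorem sum_sub_apply_eq (W : ℕ → (H →L[𝕜] H)) (σ : ℕ → H) (K : ℕ) :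
    ∑ i ∈ Finset.range K, (W i - W (i + 1)) (σ (i + 1))
      = W 0 (σ 0) + ∑ i ∈ Finset.range K, W i (σ (i + 1) - σ i) - W K (σ K) := by
  induction K with
  | zero => simp
  | succ K ih =>
    rw [Finset.sum_range_succ, Finset.sum_range_succ, ih]
    simp only [sub_apply, map_sub]
    abel

theorem commute_fundSol (S : H →L[𝕜] H) (k : ℕ) : Commute S (fundSol S k) := by
  induction k using Nat.twoStepInduction with
  | zero => exact Commute.zero_right _
  | one => exact Commute.one_right _
  | more k h1 h2 =>
    rw [fundSol_add_two]
    exact (Commute.refl S).mul_right (h2.add_right (h2.sub_right h1))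

/-- Variation of constants for the recursion `w₂ = S (2 w₁ - w₀) + r`. -/
theorem eq_sum_fundSol {z r : ℕ → H} (K : ℕ) (h0 : z 0 = 0) (h1 : z 1 = r 0)
    (hz : ∀ k < K, z (k + 2) = S (z (k + 1) + (z (k + 1) - z k)) + r (k + 1)) (k : ℕ)
    (hk : k ≤ K + 1) : z k = ∑ i ∈ Finset.range k, fundSol S (k - i) (r i) := by
  induction k using Nat.twoStepInduction with
  | zero => simpa using h0
  | one => simpa [fundSol] using h1
  | more k ih1 ih2 =>
    have e1 : z k = ∑ i ∈ Finset.range (k + 1), fundSol S (k - i) (r i) := by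
      rw [ih1 (by omega), Finset.sum_range_succ]
      simp [fundSol]
    rw [hz k (by omega), ih2 (by omega), e1, Finset.sum_range_succ _ (k + 1),
      ← Finset.sum_sub_distrib, ← Finset.sum_add_distrib, map_sum]
    congr 1
    · refine Finset.sum_congr rfl fun i hi => ?_
      have hi' : i ≤ k := Nat.lt_succ_iff.1 (Finset.mem_range.1 hi)
      rw [show k + 1 + 1 - i = (k - i) + 2 by omega, show k + 1 - i = (k - i) + 1 by omega,
        fundSol_add_two]
      simp
    · simp [show k + 1 + 1 - (k + 1) = 1 by omega, fundSol]

variable [CompleteSpace H]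

theorem re_inner_comm_of_isSelfAdjoint (hS : IsSelfAdjoint S) (x y : H) :
    RCLike.re (inner 𝕜 (S x) y) = RCLike.re (inner 𝕜 (S y) x) := by
  have h := ContinuousLinearMap.isSelfAdjoint_iff_isSymmetric.1 hS x y
  simp only [ContinuousLinearMap.coe_coe] at h
  rw [h, inner_re_symm]

theorem IsFirm.one_sub (hL : IsFirm L) : IsFirm (1 - L) := by
  refine ⟨(IsSelfAdjoint.one _).sub hL.selfAdjoint, fun x => ?_⟩
  have h := hL.norm_sq_le x
  simp only [sub_apply, one_apply_eq_self]
  rw [norm_sub_sq (𝕜 := 𝕜), inner_sub_left, map_sub, inner_self_eq_norm_sq, inner_re_symm]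
  linarith

theorem IsFirm.norm_apply_le (hL : IsFirm L) (x : H) : ‖L x‖ ≤ ‖x‖ := by
  have h := (hL.norm_sq_le x).trans ((RCLike.re_le_norm _).trans (norm_inner_le_norm _ _))
  rcases (norm_nonneg (L x)).eq_or_lt with h0 | h0
  · rw [← h0]; positivity
  · nlinarith

theorem IsFirm.re_inner_nonneg (hL : IsFirm L) (x : H) : 0 ≤ RCLike.re (inner 𝕜 (L x) x) :=
  (sq_nonneg _).trans (hL.norm_sq_le x)

/-- $\|2Lx-x\|^2=\|x\|^2+4(\|Lx\|^2-(Lx,x))$. -/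
theorem IsFirm.norm_reflect_le (hL : IsFirm L) (x : H) : ‖L x - (1 - L) x‖ ≤ ‖x‖ := by
  refine le_of_sq_le_sq ?_ (norm_nonneg _)
  have h := hL.norm_sq_le x
  have : L x - (1 - L) x = (L x + L x) - x := by
    simp only [sub_apply, one_apply_eq_self]; abel
  rw [this, norm_sub_sq (𝕜 := 𝕜), inner_add_left, map_add, norm_add_sq (𝕜 := 𝕜),
    inner_self_eq_norm_sq]
  linarith

/-- The discrete energy of two consecutive terms of a solution of `w₂ = S (2 w₁ - w₀)`. -/
def energy (S : H →L[𝕜] H) (w w₁ : H) : ℝ :=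
  ‖w₁‖ ^ 2 - RCLike.re (inner 𝕜 (S w₁) w₁) + RCLike.re (inner 𝕜 (S (w₁ - w)) (w₁ - w))

/-- A self-adjoint operator `S` with `0 ≤ S ≤ 1` in the sense of quadratic forms. -/
structure IsContrPos (S : H →L[𝕜] H) : Prop where
  selfAdjoint : IsSelfAdjoint S
  nonneg : ∀ x, 0 ≤ RCLike.re (inner 𝕜 (S x) x)
  le_sq : ∀ x, RCLike.re (inner 𝕜 (S x) x) ≤ ‖x‖ ^ 2

/-- With $q=2w_1-w$ and next term $w_2=Sq$, this expresses the energy through the new step $w_2-w_1$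
and the gap $(Sq,q)-\|Sq\|^2$. The latter is nonnegative and dominates the $1-S$ form at $w_2$, so
both the step bound and the monotonicity can be read off. -/
theorem IsContrPos.energy_eq (hS : IsContrPos S) (w w₁ : H) :
    energy S w w₁ = ‖S (w₁ + (w₁ - w)) - w₁‖ ^ 2
      + (RCLike.re (inner 𝕜 (S (w₁ + (w₁ - w))) (w₁ + (w₁ - w))) - ‖S (w₁ + (w₁ - w))‖ ^ 2) := by
  have hc := re_inner_comm_of_isSelfAdjoint hS.selfAdjoint
  set e := w₁ - w with he
  rw [energy, norm_sub_sq (𝕜 := 𝕜), map_add, inner_add_left, inner_add_left, inner_add_right,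
    inner_add_right]
  simp only [map_add]
  rw [hc e w₁]
  ring

/-- This is $S\ge0$ tested on $q-Sq$. -/
theorem IsContrPos.norm_sq_step_le (hS : IsContrPos S) (q : H) :
    ‖S q‖ ^ 2 - RCLike.re (inner 𝕜 (S (S q)) (S q)) ≤ RCLike.re (inner 𝕜 (S q) q) - ‖S q‖ ^ 2 := by
  have hc := re_inner_comm_of_isSelfAdjoint hS.selfAdjoint
  have h := hS.nonneg (q - S q)
  rw [map_sub, inner_sub_left, inner_sub_right, inner_sub_right] at h
  simp only [map_sub] at h
  rw [hc (S q) q, inner_self_eq_norm_sq] at h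
  linarith

theorem IsContrPos.norm_step_sq_le_energy (hS : IsContrPos S) (w w₁ : H) :
    ‖S (w₁ + (w₁ - w)) - w₁‖ ^ 2 ≤ energy S w w₁ := by
  rw [hS.energy_eq]
  have h1 := hS.norm_sq_step_le (w₁ + (w₁ - w))
  have h2 := hS.le_sq (S (w₁ + (w₁ - w)))
  linarith

theorem IsContrPos.energy_step_le (hS : IsContrPos S) (w w₁ : H) :
    energy S w₁ (S (w₁ + (w₁ - w))) ≤ energy S w w₁ := by
  rw [hS.energy_eq w w₁, energy]
  have h1 := hS.norm_sq_step_le (w₁ + (w₁ - w))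
  have h2 := hS.le_sq (S (w₁ + (w₁ - w)) - w₁)
  linarith

theorem IsContrPos.energy_seq_le (hS : IsContrPos S) {w : ℕ → H}
    (hw : ∀ k, w (k + 2) = S (w (k + 1) + (w (k + 1) - w k))) (k : ℕ) :
    energy S (w k) (w (k + 1)) ≤ energy S (w 0) (w 1) := by
  induction k with
  | zero => exact le_rfl
  | succ k ih =>
    refine le_trans ?_ ih
    rw [hw k]
    exact hS.energy_step_le _ _

theorem isSelfAdjoint_fundSol (hS : IsSelfAdjoint S) (k : ℕ) : IsSelfAdjoint (fundSol S k) := by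
  induction k using Nat.twoStepInduction with
  | zero => exact IsSelfAdjoint.zero _
  | one => exact IsSelfAdjoint.one _
  | more k h1 h2 =>
    rw [fundSol_add_two]
    have h3 := h2.add (h2.sub h1)
    refine (IsSelfAdjoint.commute_iff hS h3).1 ?_
    exact (commute_fundSol S _).add_right ((commute_fundSol S _).sub_right (commute_fundSol S _))

theorem IsContrPos.energy_fundSol_le (hS : IsContrPos S) (x : H) (k : ℕ) :
    energy S (fundSol S k x) (fundSol S (k + 1) x) ≤ ‖x‖ ^ 2 := by
  have h := hS.energy_seq_le (w := fun k => fundSol S k x)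
    (fun k => by simp [fundSol_add_two]) k
  refine h.trans (le_of_eq ?_)
  simp [energy, fundSol]

theorem IsContrPos.norm_fundSol_sub_le (hS : IsContrPos S) (x : H) (k : ℕ) :
    ‖(fundSol S (k + 1) - fundSol S k) x‖ ≤ ‖x‖ := by
  cases k with
  | zero => simp [fundSol]
  | succ k =>
    refine le_of_sq_le_sq ?_ (norm_nonneg _)
    refine le_trans ?_ (hS.energy_fundSol_le x k)
    have := hS.norm_step_sq_le_energy (fundSol S k x) (fundSol S (k + 1) x)
    simpa [fundSol_add_two] using this

/-- `W` maps `x` to a vector whose `1 - S`-form is at most `‖x‖²`. -/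
def IsDefectBounded (S W : H →L[𝕜] H) : Prop :=
  IsSelfAdjoint W ∧ ∀ x, ‖W x‖ ^ 2 - RCLike.re (inner 𝕜 (S (W x)) (W x)) ≤ ‖x‖ ^ 2

theorem IsContrPos.defect_le_energy (hS : IsContrPos S) (w w₁ : H) :
    ‖w₁‖ ^ 2 - RCLike.re (inner 𝕜 (S w₁) w₁) ≤ energy S w w₁ := by
  have := hS.nonneg (w₁ - w)
  rw [energy]
  linarith

theorem IsContrPos.isDefectBounded_fundSol (hS : IsContrPos S) (k : ℕ) :
    IsDefectBounded S (fundSol S (k + 1)) :=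
  ⟨isSelfAdjoint_fundSol hS.selfAdjoint _, fun x =>
    (hS.defect_le_energy _ _).trans (hS.energy_fundSol_le x k)⟩

/-- The sequence $2V_{k+1}-V_k$ solves the same recursion, and its initial values $2x$ and $4Sx-x$
have energy exactly $\|x\|^2$. Bounding the combination as a whole avoids adding the bounds of its
two parts. -/
theorem IsContrPos.isDefectBounded_fundSol_extrapolate (hS : IsContrPos S) (k : ℕ) :
    IsDefectBounded S (fundSol S (k + 2) + (fundSol S (k + 2) - fundSol S (k + 1))) := by
  have hV := isSelfAdjoint_fundSol hS.selfAdjoint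
  refine ⟨(hV _).add ((hV _).sub (hV _)), fun x => ?_⟩
  let w : ℕ → H := fun k => (fundSol S (k + 1) + (fundSol S (k + 1) - fundSol S k)) x
  have h := hS.energy_seq_le (w := w)
    (fun k => by simp [w, fundSol_add_two]) k
  refine (hS.defect_le_energy (w k) (w (k + 1))).trans (h.trans (le_of_eq ?_))
  have hc := re_inner_comm_of_isSelfAdjoint hS.selfAdjoint
  have h0 : w 0 = x + x := by simp [w, fundSol]
  have h1 : w 1 = S x + S x + S x + S x - x := by simp [w, fundSol]; abel
  rw [h0, h1, energy]
  have hsymm : ∀ a b, RCLike.re (inner 𝕜 a (S b)) = RCLike.re (inner 𝕜 (S b) a) :=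
    fun a b => inner_re_symm _ _
  have e2 : RCLike.re (inner 𝕜 (S (S x)) x) = ‖S x‖ ^ 2 := by
    rw [hc, inner_self_eq_norm_sq]
  rw [← inner_self_eq_norm_sq (𝕜 := 𝕜)]
  simp only [map_add, map_sub, inner_add_left, inner_add_right, inner_sub_left, inner_sub_right,
    inner_self_eq_norm_sq, hsymm x x, e2]
  ring

/-- If `η P ≤ 1 - S` then `W P` is bounded by `η^{-1/2}`. -/
theorem IsDefectBounded.norm_comp_le {W P : H →L[𝕜] H} (hW : IsDefectBounded S W) (hP : IsFirm P)
    {η : ℝ} (hη : 0 < η)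
    (hle : ∀ x, η * RCLike.re (inner 𝕜 (P x) x) ≤ ‖x‖ ^ 2 - RCLike.re (inner 𝕜 (S x) x))
    (x : H) : ‖W (P x)‖ ≤ η ^ (-(1 / 2) : ℝ) * ‖x‖ := by
  -- The energy controls what $P$ does after $W$; self-adjointness of both transfers the norm bound
  -- to $WP=(PW)^*$.
  have h1 : ‖P * W‖ ≤ η ^ (-(1 / 2) : ℝ) := by
    refine ContinuousLinearMap.opNorm_le_bound _ (by positivity) fun y => ?_
    refine le_of_sq_le_sq ?_ (by positivity)
    have h2 := hP.norm_sq_le (W y)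
    have h3 := (hle (W y)).trans (hW.2 y)
    have h4 : (η ^ (-(1 / 2) : ℝ)) ^ 2 = η⁻¹ := by
      rw [← Real.rpow_natCast, ← Real.rpow_mul hη.le, ← Real.rpow_neg_one]
      norm_num
    rw [mul_pow, h4, mul_apply_eq_comp, inv_mul_eq_div, le_div_iff₀ hη]
    nlinarith
  have h2 : ‖W * P‖ = ‖P * W‖ := by
    rw [← norm_star, star_mul, hP.selfAdjoint.star_eq, hW.1.star_eq]
  exact (W * P).le_of_opNorm_le (h2.trans_le h1) x

end Recursion

/-! ### Stability of the averaged scheme -/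

section Stability

variable {𝕜 : Type*} [RCLike 𝕜] {H : Type*} [NormedAddCommGroup H] [InnerProductSpace 𝕜 H]
  {m : ℕ} {L : Fin m → H →L[𝕜] H} {η : Fin m → ℝ}

/-- The transition operator `∑ⱼ ηⱼ Lⱼ` of the averaged scheme. -/
def transition (L : Fin m → H →L[𝕜] H) (η : Fin m → ℝ) : H →L[𝕜] H := ∑ j, (η j : 𝕜) • L j

theorem transition_apply (x : H) : transition L η x = ∑ j, (η j : 𝕜) • L j x := by
  simp [transition]

theorem re_inner_transition (x : H) :
    RCLike.re (inner 𝕜 (transition L η x) x) = ∑ j, η j * RCLike.re (inner 𝕜 (L j x) x) := by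
  rw [transition_apply, sum_inner, map_sum]
  refine Finset.sum_congr rfl fun j _ => ?_
  rw [inner_smul_left, RCLike.conj_ofReal, RCLike.re_ofReal_mul]

/-- Because the weights sum to one, $1-S=\sum_j\eta_j(1-L_j)$; each summand is nonnegative, hence
below $1-S$. -/
theorem sq_sub_re_inner_transition (hsum : ∑ j, η j = 1) (x : H) :
    ‖x‖ ^ 2 - RCLike.re (inner 𝕜 (transition L η x) x)
      = ∑ j, η j * RCLike.re (inner 𝕜 ((1 - L j) x) x) := by
  rw [re_inner_transition, ← one_mul (‖x‖ ^ 2), ← hsum, Finset.sum_mul, ← Finset.sum_sub_distrib]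
  refine Finset.sum_congr rfl fun j _ => ?_
  simp only [sub_apply, one_apply_eq_self]
  rw [inner_sub_left, map_sub, inner_self_eq_norm_sq]
  ring

variable [CompleteSpace H]

theorem mul_re_inner_one_sub_le (hL : ∀ j, IsFirm (L j)) (hη : ∀ j, 0 < η j)
    (hsum : ∑ j, η j = 1) (j : Fin m) (x : H) :
    η j * RCLike.re (inner 𝕜 ((1 - L j) x) x)
      ≤ ‖x‖ ^ 2 - RCLike.re (inner 𝕜 (transition L η x) x) := by
  rw [sq_sub_re_inner_transition hsum]
  exact Finset.single_le_sum (f := fun j => η j * RCLike.re (inner 𝕜 ((1 - L j) x) x))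
    (fun i _ => mul_nonneg (hη i).le ((hL i).one_sub.re_inner_nonneg x)) (Finset.mem_univ j)

theorem isContrPos_transition (hL : ∀ j, IsFirm (L j)) (hη : ∀ j, 0 < η j) (hsum : ∑ j, η j = 1) :
    IsContrPos (transition L η) := by
  refine ⟨?_, fun x => ?_, fun x => ?_⟩
  · rw [transition, isSelfAdjoint_iff, star_sum]
    refine Finset.sum_congr rfl fun j _ => ?_
    rw [star_smul, (hL j).selfAdjoint.star_eq, RCLike.star_def, RCLike.conj_ofReal]
  · rw [re_inner_transition]
    exact Finset.sum_nonneg fun j _ => mul_nonneg (hη j).le ((hL j).re_inner_nonneg x)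
  · rw [← sub_nonneg, sq_sub_re_inner_transition hsum]
    exact Finset.sum_nonneg fun j _ => mul_nonneg (hη j).le ((hL j).one_sub.re_inner_nonneg x)

theorem one_le_rpow_neg_half {x : ℝ} (h0 : 0 < x) (h1 : x ≤ 1) : 1 ≤ x ^ (-(1 / 2) : ℝ) :=
  Real.one_le_rpow_of_pos_of_le_one_of_nonpos h0 h1 (by norm_num)

/-- The contribution of one time step after summation by parts. -/
theorem norm_fundSol_increment_le [NeZero m] (hL : ∀ j, IsFirm (L j))
    (hη : ∀ j, 0 < η j ∧ η j < 1) (hsum : ∑ j, η j = 1) (l : ℕ) (φ : H) (Y : Fin m → H) :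
    ‖fundSol (transition L η) (l + 1) ((1 - L 0) φ - ∑ j, (1 - L j) (Y j))
        + (fundSol (transition L η) (l + 1) - fundSol (transition L η) l) (∑ j, L j (Y j))‖
      ≤ η 0 ^ (-(1 / 2) : ℝ) * ‖φ‖ + ∑ j, η j ^ (-(1 / 2) : ℝ) * ‖Y j‖ + ‖∑ j, Y j‖ := by
  have hS := isContrPos_transition hL (fun j => (hη j).1) hsum
  have hle := mul_re_inner_one_sub_le hL (fun j => (hη j).1) hsum
  have h1 := (hS.isDefectBounded_fundSol l).norm_comp_le (hL 0).one_sub (hη 0).1 (hle 0) φ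
  have key : ‖-fundSol (transition L η) (l + 1) (∑ j, (1 - L j) (Y j))
      + (fundSol (transition L η) (l + 1) - fundSol (transition L η) l) (∑ j, L j (Y j))‖
      ≤ ∑ j, η j ^ (-(1 / 2) : ℝ) * ‖Y j‖ + ‖∑ j, Y j‖ := by
    cases l with
    -- Here $2V_1-V_0=2$ is outside the extrapolated bound; since $V_1=1$, $V_0=0$, the reflections
    -- $L_j-(1-L_j)$ appear, which are contractions.
    | zero =>
      have e : -fundSol (transition L η) (0 + 1) (∑ j, (1 - L j) (Y j))
          + (fundSol (transition L η) (0 + 1) - fundSol (transition L η) 0) (∑ j, L j (Y j))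
          = ∑ j, (L j (Y j) - (1 - L j) (Y j)) := by
        rw [Finset.sum_sub_distrib]
        simp only [fundSol, sub_zero, one_apply_eq_self]
        abel
      rw [e]
      refine le_add_of_le_of_nonneg ((norm_sum_le _ _).trans (Finset.sum_le_sum fun j _ => ?_))
        (norm_nonneg _)
      refine ((hL j).norm_reflect_le _).trans ?_
      exact le_mul_of_one_le_left (norm_nonneg _) (one_le_rpow_neg_half (hη j).1 (hη j).2.le)
    | succ l =>
      set V := fundSol (transition L η) with hV
      -- Writing $L_j=1-(1-L_j)$ collects the $1-L_j$ terms under $2V_{l+2}-V_{l+1}$, so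
      -- $\eta_j^{-1/2}$ is paid only once.
      have e : -V (l + 1 + 1) (∑ j, (1 - L j) (Y j))
          + (V (l + 1 + 1) - V (l + 1)) (∑ j, L j (Y j))
          = -∑ j, (V (l + 2) + (V (l + 2) - V (l + 1))) ((1 - L j) (Y j))
            + (V (l + 1 + 1) - V (l + 1)) (∑ j, Y j) := by
        have : ∑ j, L j (Y j) = ∑ j, Y j - ∑ j, (1 - L j) (Y j) := by
          rw [← Finset.sum_sub_distrib]
          refine Finset.sum_congr rfl fun j _ => ?_
          simp
        rw [this, map_sub, ← map_sum, add_apply]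
        abel
      rw [e]
      refine (norm_add_le _ _).trans (add_le_add ?_ (hS.norm_fundSol_sub_le _ _))
      rw [norm_neg]
      refine (norm_sum_le _ _).trans (Finset.sum_le_sum fun j _ => ?_)
      exact (hS.isDefectBounded_fundSol_extrapolate l).norm_comp_le (hL j).one_sub (hη j).1
        (hle j) (Y j)
  rw [map_sub, sub_eq_add_neg, add_assoc, add_assoc]
  exact (norm_add_le _ _).trans (add_le_add h1 key)

/-- Stability of the averaged scheme with respect to perturbations of the form produced by the
splitting. -/
theorem norm_increment_le [NeZero m] (hL : ∀ j, IsFirm (L j))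
    (hη : ∀ j, 0 < η j ∧ η j < 1) (hsum : ∑ j, η j = 1) {c : ℝ} (hc : 0 ≤ c) {z e F : ℕ → H}
    {B : ℕ → Fin m → H} (h0 : z 0 = 0) (k : ℕ)
    (hz : ∀ i < k, z (i + 2) = transition L η (z (i + 1) + (z (i + 1) - z i)) + (e i
      - (c : 𝕜) • ((1 - L 0) (F (i + 1)) - ∑ j, (1 - L j) (B (i + 1) j)
        + ∑ j, L j (B (i + 1) j - B i j)))) :
    ‖z (k + 1) - z k‖ ≤ ‖z 1‖ + ∑ i ∈ Finset.range k, ‖e i‖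
      + c * (η 0 ^ (-(1 / 2) : ℝ) * ‖F 0‖ + ∑ j, η j ^ (-(1 / 2) : ℝ) * ‖B 0 j‖)
      + c * ∑ i ∈ Finset.range k, (η 0 ^ (-(1 / 2) : ℝ) * ‖F (i + 1) - F i‖
        + ∑ j, η j ^ (-(1 / 2) : ℝ) * ‖B (i + 1) j - B i j‖ + ‖∑ j, (B (i + 1) j - B i j)‖) := by
  have hS := isContrPos_transition hL (fun j => (hη j).1) hsum
  have hle := mul_re_inner_one_sub_le hL (fun j => (hη j).1) hsum
  set S := transition L η with hSdef
  let σ : ℕ → H := fun i => (1 - L 0) (F i) - ∑ j, (1 - L j) (B i j)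
  let X : ℕ → H := fun i => ∑ j, L j (B (i + 1) j - B i j)
  -- Since $z_0=0$, the value $z_1$ acts as the source at index $0$.
  let r : ℕ → H := fun i => Nat.casesOn i (z 1) fun i => e i - (c : 𝕜) • (σ (i + 1) + X i)
  let W : ℕ → (H →L[𝕜] H) := fun i => fundSol S (k - i)
  have hsol := eq_sum_fundSol (S := S) (z := z) (r := r) k h0 rfl (fun i hi => hz i hi)
  -- The null term $V_0r_k$ is appended so that both sums run over the same range.
  have e1 : z k = ∑ i ∈ Finset.range (k + 1), fundSol S (k - i) (r i) := by
    rw [hsol k (by omega), Finset.sum_range_succ]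
    simp [fundSol]
  have hr : ∀ i, r (i + 1) = e i - (c : 𝕜) • (σ (i + 1) + X i) := fun i => rfl
  have e2 : z (k + 1) - z k = (fundSol S (k + 1) - fundSol S k) (z 1)
      + ∑ i ∈ Finset.range k, (W i - W (i + 1)) (e i)
      - (c : 𝕜) • (fundSol S k (σ 0) + ∑ i ∈ Finset.range k, (W i (σ (i + 1) - σ i)
        + (W i - W (i + 1)) (X i))) := by
    have hab := sum_sub_apply_eq W σ k
    -- $V_0=0$ removes the final boundary term of the summation by parts; only the one at $\sigma_0$
    -- remains.
    have hWk : W k = 0 := by simp [W, fundSol]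
    rw [hWk, zero_apply, sub_zero] at hab
    have hW0 : W 0 = fundSol S k := rfl
    rw [Finset.sum_add_distrib, ← add_assoc, ← hW0, ← hab, ← Finset.sum_add_distrib,
      Finset.smul_sum, add_sub_assoc, ← Finset.sum_sub_distrib, hsol (k + 1) le_rfl, e1,
      ← Finset.sum_sub_distrib, Finset.sum_range_succ', add_comm]
    congr 1
    refine Finset.sum_congr rfl fun i _ => ?_
    rw [hr, Nat.add_sub_add_right]
    simp only [W, sub_apply, map_sub, map_add, map_smul, smul_add, smul_sub]
    abel
  have hW : ∀ i ∈ Finset.range k, W i = fundSol S (k - (i + 1) + 1) := fun i hi => by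
    have := Finset.mem_range.1 hi
    simp only [W]
    congr 1
    omega
  rw [e2]
  have b1 := hS.norm_fundSol_sub_le (z 1) k
  have b2 : ‖∑ i ∈ Finset.range k, (W i - W (i + 1)) (e i)‖ ≤ ∑ i ∈ Finset.range k, ‖e i‖ := by
    refine (norm_sum_le _ _).trans (Finset.sum_le_sum fun i hi => ?_)
    rw [hW i hi]
    exact hS.norm_fundSol_sub_le _ _
  have hnc : ∀ y : H, ‖(c : 𝕜) • y‖ = c * ‖y‖ := fun y => by
    rw [norm_smul, RCLike.norm_ofReal, abs_of_nonneg hc]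
  have b3 : ‖fundSol S k (σ 0)‖
      ≤ η 0 ^ (-(1 / 2) : ℝ) * ‖F 0‖ + ∑ j, η j ^ (-(1 / 2) : ℝ) * ‖B 0 j‖ := by
    cases k with
    | zero =>
      simp only [fundSol, zero_apply, norm_zero]
      have : ∀ j, 0 ≤ η j ^ (-(1 / 2) : ℝ) := fun j => Real.rpow_nonneg (hη j).1.le _
      exact add_nonneg (mul_nonneg (this 0) (norm_nonneg _))
        (Finset.sum_nonneg fun j _ => mul_nonneg (this j) (norm_nonneg _))
    | succ k =>
      have hd := hS.isDefectBounded_fundSol k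
      simp only [σ, map_sub, map_sum]
      refine (norm_sub_le _ _).trans (add_le_add ?_ ((norm_sum_le _ _).trans
        (Finset.sum_le_sum fun j _ => ?_)))
      · exact hd.norm_comp_le (hL 0).one_sub (hη 0).1 (hle 0) _
      · exact hd.norm_comp_le (hL j).one_sub (hη j).1 (hle j) _
  have b4 : ‖∑ i ∈ Finset.range k, (W i (σ (i + 1) - σ i) + (W i - W (i + 1)) (X i))‖
      ≤ ∑ i ∈ Finset.range k, (η 0 ^ (-(1 / 2) : ℝ) * ‖F (i + 1) - F i‖
        + ∑ j, η j ^ (-(1 / 2) : ℝ) * ‖B (i + 1) j - B i j‖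
        + ‖∑ j, (B (i + 1) j - B i j)‖) := by
    refine (norm_sum_le _ _).trans (Finset.sum_le_sum fun i hi => ?_)
    have hσ : σ (i + 1) - σ i
        = (1 - L 0) (F (i + 1) - F i) - ∑ j, (1 - L j) (B (i + 1) j - B i j) := by
      simp only [σ, map_sub, Finset.sum_sub_distrib]
      abel
    rw [hW i hi, hσ]
    exact norm_fundSol_increment_le hL hη hsum _ _ _
  refine (norm_sub_le _ _).trans ?_
  rw [hnc]
  have b5 := mul_le_mul_of_nonneg_left
    ((norm_add_le (fundSol S k (σ 0)) _).trans (add_le_add b3 b4)) hc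
  rw [mul_add] at b5
  have b6 := (norm_add_le ((fundSol S (k + 1) - fundSol S k) (z 1)) _).trans (add_le_add b1 b2)
  linarith

end Stability

/-! ### Consistency of the second central difference -/

section Taylor

variable {H : Type*} [NormedAddCommGroup H] [NormedSpace ℝ H]

theorem secondDeriv_eq {T : ℝ} (hT : 0 < T) {u : ℝ → H} (hu : ContDiffOn ℝ 2 u (Icc 0 T)) :
    DifferentiableOn ℝ u (Icc 0 T) ∧ DifferentiableOn ℝ (derivWithin u (Icc 0 T)) (Icc 0 T) ∧
      secondDeriv T u = derivWithin (derivWithin u (Icc 0 T)) (Icc 0 T) ∧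
      ContinuousOn (secondDeriv T u) (Icc 0 T) := by
  have hs := uniqueDiffOn_Icc hT
  have h1 : ContDiffOn ℝ 1 (derivWithin u (Icc 0 T)) (Icc 0 T) := hu.derivWithin hs (by norm_num)
  have e : secondDeriv T u = derivWithin (derivWithin u (Icc 0 T)) (Icc 0 T) := by
    funext t
    rw [secondDeriv, iteratedDerivWithin_succ]
    congr 1
    funext t
    rw [iteratedDerivWithin_one]
  refine ⟨hu.differentiableOn (by norm_num), h1.differentiableOn (by norm_num), e, ?_⟩
  exact hu.continuousOn_iteratedDerivWithin (by norm_num) hs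

/-- The second central difference approximates `τ² u''`. -/
theorem norm_second_difference_le [CompleteSpace H] {T : ℝ} (hT : 0 < T) {u : ℝ → H}
    (hu : ContDiffOn ℝ 2 u (Icc 0 T)) {s τ : ℝ} (hτ : 0 ≤ τ) (h0 : 0 ≤ s - τ) (h1 : s + τ ≤ T) :
    ‖u (s + τ) - u s - (u s - u (s - τ)) - τ ^ 2 • secondDeriv T u s‖
      ≤ τ * ∫ t in (s - τ)..(s + τ), ‖secondDeriv T u s - secondDeriv T u t‖ := by
  obtain ⟨d1, d2, e, hc⟩ := secondDeriv_eq hT hu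
  set u2 := secondDeriv T u with hu2
  set u1 := derivWithin u (Icc 0 T) with hu1
  have D1 : ∀ t ∈ Ioo 0 T, HasDerivAt u (u1 t) t := fun t ht =>
    ((d1 t (Ioo_subset_Icc_self ht)).hasDerivWithinAt).hasDerivAt (Icc_mem_nhds ht.1 ht.2)
  have D2 : ∀ t ∈ Ioo 0 T, HasDerivAt u1 (u2 t) t := fun t ht => by
    rw [e]
    exact ((d2 t (Ioo_subset_Icc_self ht)).hasDerivWithinAt).hasDerivAt (Icc_mem_nhds ht.1 ht.2)
  set C := ∫ t in (s - τ)..(s + τ), ‖u2 s - u2 t‖ with hC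
  have hcn : ContinuousOn (fun t => ‖u2 s - u2 t‖) (Icc 0 T) :=
    (continuousOn_const.sub hc).norm
  -- The step length is the variable: $g'(h)=\int_{s-h}^{s+h}(u''(t)-u''(s))\,dt$ is at most `C` in
  -- norm, and the mean value inequality on $[0,\tau]$ supplies the factor $\tau$.
  let g : ℝ → H := fun h => u (s + h) + u (s - h) - h ^ 2 • u2 s
  let g' : ℝ → H := fun h => u1 (s + h) - u1 (s - h) - (2 * h) • u2 s
  have hbound : ∀ h ∈ Ico 0 τ, ‖g' h‖ ≤ C := by
    intro h hh
    have hsub : Icc (s - h) (s + h) ⊆ Icc 0 T :=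
      Icc_subset_Icc (by linarith [hh.2]) (by linarith [hh.2])
    have hle : s - h ≤ s + h := by linarith [hh.1]
    have hint : IntervalIntegrable u2 MeasureTheory.volume (s - h) (s + h) :=
      ContinuousOn.intervalIntegrable (by rw [uIcc_of_le hle]; exact hc.mono hsub)
    have ftc : ∫ t in (s - h)..(s + h), u2 t = u1 (s + h) - u1 (s - h) :=
      intervalIntegral.integral_eq_sub_of_hasDerivAt_of_le hle (d2.continuousOn.mono hsub)
        (fun t ht => D2 t ⟨by linarith [hh.2, ht.1], by linarith [hh.2, ht.2]⟩) hint
    have eg : g' h = ∫ t in (s - h)..(s + h), (u2 t - u2 s) := by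
      rw [intervalIntegral.integral_sub hint (by simp), ftc, intervalIntegral.integral_const]
      simp only [g']
      congr 2
      ring
    rw [eg]
    refine (intervalIntegral.norm_integral_le_integral_norm hle).trans ?_
    simp_rw [norm_sub_rev (u2 _) (u2 s)]
    refine intervalIntegral.integral_mono_interval (by linarith [hh.2]) hle (by linarith [hh.2])
      (Filter.Eventually.of_forall fun t => norm_nonneg _) ?_
    refine ContinuousOn.intervalIntegrable (hcn.mono ?_)
    rw [uIcc_of_le (by linarith)]
    exact Icc_subset_Icc h0 h1
  have hgc : ContinuousOn g (Icc 0 τ) := by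
    refine ContinuousOn.sub (ContinuousOn.add ?_ ?_) (by fun_prop)
    · refine d1.continuousOn.comp (by fun_prop) fun h hh => ⟨?_, ?_⟩ <;> linarith [hh.1, hh.2]
    · refine d1.continuousOn.comp (by fun_prop) fun h hh => ⟨?_, ?_⟩ <;> linarith [hh.1, hh.2]
  have hgd : ∀ h ∈ Ico 0 τ, HasDerivWithinAt g (g' h) (Ici h) h := by
    intro h hh
    have a1 : HasDerivAt (fun h => u (s + h)) (u1 (s + h)) h :=
      (D1 (s + h) ⟨by linarith [hh.1, hh.2], by linarith [hh.1, hh.2]⟩).comp_const_add s h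
    have a2 : HasDerivAt (fun h => u (s - h)) (-u1 (s - h)) h :=
      (D1 (s - h) ⟨by linarith [hh.1, hh.2], by linarith [hh.1, hh.2]⟩).comp_const_sub s h
    have a3 : HasDerivAt (fun h : ℝ => h ^ 2 • u2 s) ((2 * h) • u2 s) h := by
      have := (hasDerivAt_pow 2 h).smul_const (u2 s)
      simpa using this
    have := (a1.add a2).sub a3
    rw [← sub_eq_add_neg] at this
    exact this.hasDerivWithinAt
  have := norm_image_sub_le_of_norm_deriv_right_le_segment hgc hgd hbound τ
    (right_mem_Icc.2 hτ)
  have e1 : g τ - g 0 = u (s + τ) - u s - (u s - u (s - τ)) - τ ^ 2 • u2 s := by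
    simp only [g, add_zero, sub_zero]
    simp
    abel
  rw [e1] at this
  linarith

end Taylor

/-! ### Comparison of the constants -/

section Constants

variable {m : ℕ} {η a' : Fin m → ℝ}

theorem c₀_nonneg (hη : ∀ j, 0 < η j ∧ η j < 1) (ha' : ∀ j, 0 ≤ a' j) : 0 ≤ c₀ η a' :=
  Finset.sum_nonneg fun j _ => mul_nonneg (Real.rpow_nonneg (hη j).1.le _) (ha' j)

theorem one_le_natCast_of_neZero [NeZero m] : (1 : ℝ) ≤ m := by
  exact_mod_cast Nat.one_le_iff_ne_zero.2 (NeZero.ne m)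

theorem c₀_add_one_le_c₁ [NeZero m] (hη : ∀ j, 0 < η j ∧ η j < 1) (ha' : ∀ j, 0 ≤ a' j) :
    c₀ η a' + 1 ≤ c₁ η a' := by
  have h : c₀ η a' + m ≤ c₁ η a' := by
    have : (m : ℝ) = ∑ _j : Fin m, (1 : ℝ) := by simp
    rw [this, c₀, c₁, ← Finset.sum_add_distrib]
    refine Finset.sum_le_sum fun j _ => ?_
    have h1 : η j ^ (-(1 / 2) : ℝ) ≤ η j ^ (-(3 / 2) : ℝ) :=
      Real.rpow_le_rpow_of_exponent_ge (hη j).1 (hη j).2.le (by norm_num)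
    have h2 := one_le_rpow_neg_half (hη j).1 (hη j).2.le
    have h3 : 1 ≤ (η j)⁻¹ := (one_le_inv₀ (hη j).1).2 (hη j).2.le
    have h4 : a' j ≤ (η j)⁻¹ * a' j := le_mul_of_one_le_left (ha' j) h3
    have h5 : η j ^ (-(1 / 2) : ℝ) * a' j ≤ η j ^ (-(3 / 2) : ℝ) * ((η j)⁻¹ * a' j) :=
      mul_le_mul h1 h4 (ha' j) (by linarith)
    linarith
  have := one_le_natCast_of_neZero (m := m)
  linarith

theorem c₄_nonneg (hη : ∀ j, 0 < η j ∧ η j < 1) (ha' : ∀ j, 0 ≤ a' j) : 0 ≤ c₄ η a' :=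
  Finset.sum_nonneg fun j _ => by
    have := inv_nonneg.2 (hη j).1.le
    have := ha' j
    positivity

theorem c₀_add_one_le_c₅ [NeZero m] (hη : ∀ j, 0 < η j ∧ η j < 1) (ha' : ∀ j, 0 ≤ a' j) :
    c₀ η a' + 1 ≤ c₅ η a' := by
  have h1 := c₀_add_one_le_c₁ hη ha'
  have h2 := c₄_nonneg hη ha'
  rw [c₅]
  linarith

theorem c₀_add_one_add_le_c₆ [NeZero m] (η a' : Fin m → ℝ) :
    c₀ η a' + 1 + η 0 ^ (-(1 / 2) : ℝ) ≤ c₆ η a' := by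
  have := one_le_natCast_of_neZero (m := m)
  rw [c₆]
  linarith

theorem c₆_le_c₇ [NeZero m] (hη : ∀ j, 0 < η j ∧ η j < 1) (ha' : ∀ j, 0 ≤ a' j) :
    c₆ η a' ≤ c₇ η a' := by
  have h1 := c₀_add_one_le_c₁ hη ha'
  have h2 := c₄_nonneg hη ha'
  have h3 := c₀_nonneg hη ha'
  rw [c₇]
  linarith

theorem sum_Icc_one_eq_sum_range (g : ℕ → ℝ) (k : ℕ) :
    ∑ i ∈ Finset.Icc 1 k, g i = ∑ i ∈ Finset.range k, g (i + 1) := by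
  rw [Finset.range_eq_Ico, Finset.sum_Ico_add' g 0 k 1]
  rfl

end Constants

/-! ### Error recursion for the scheme -/

section Scheme

variable {𝕜 : Type*} [RCLike 𝕜] {H : Type*} [NormedAddCommGroup H] [InnerProductSpace 𝕜 H]

/-- With $d=\eta/t$, this is $d(x-Lx)=LTx$ multiplied by $t$. It puts the exact solution into the
form of the recursion, with $t=\tau^2$. -/
theorem smul_one_sub_resolvent {T : H →ₗ.[𝕜] H} {L : H →L[𝕜] H} {η t : ℝ} (ht : t ≠ 0)
    (hL : ∀ x : T.domain, L (((η / t : ℝ) : 𝕜) • (x : H) + T x) = ((η / t : ℝ) : 𝕜) • (x : H))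
    (x : T.domain) : (η : 𝕜) • ((x : H) - L x) = (t : 𝕜) • L (T x) := by
  have h := hL x
  have ht' : (t : 𝕜) ≠ 0 := RCLike.ofReal_ne_zero.2 ht
  have e : (η : 𝕜) = (t : 𝕜) * ((η / t : ℝ) : 𝕜) := by
    rw [← RCLike.ofReal_mul, mul_div_cancel₀ _ ht]
  rw [map_add, map_smul] at h
  rw [e]
  linear_combination (norm := module) -(t : 𝕜) • h

theorem smul_eq_of_resolvent_equation {T : H →ₗ.[𝕜] H} {L : H →L[𝕜] H} {η t : ℝ} (ht : t ≠ 0)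
    (hL : ∀ x : T.domain, L (((η / t : ℝ) : 𝕜) • (x : H) + T x) = ((η / t : ℝ) : 𝕜) • (x : H))
    (y : T.domain) {q g : H} (h : (η : 𝕜) • (((t⁻¹ : ℝ) : 𝕜) • ((y : H) - q)) + T y = g) :
    (η : 𝕜) • (y : H) = (η : 𝕜) • L q + (t : 𝕜) • L g := by
  have h1 := smul_one_sub_resolvent ht hL y
  have e : (t : 𝕜) * ((t⁻¹ : ℝ) : 𝕜) = 1 := by
    rw [← RCLike.ofReal_mul, mul_inv_cancel₀ ht, RCLike.ofReal_one]
  have h2 : (t : 𝕜) • L g = (η : 𝕜) • (L y - L q) + (t : 𝕜) • L (T y) := by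
    rw [← h, map_add, map_smul, map_smul, map_sub, smul_add, smul_comm (t : 𝕜), smul_smul (t : 𝕜),
      e, one_smul]
  rw [h2, ← h1]
  module

/-- One step of the scheme in terms of the transition operator. -/
theorem IsApproxSolution.step [NormedSpace ℝ H] {m : ℕ} [NeZero m] {A : Fin m → H →ₗ.[𝕜] H}
    {η : Fin m → ℝ} {M : H → H} {f : ℝ → H} {φ₀ φ₁ : H} {τ : ℝ} {n : ℕ} {v : ℕ → H}
    {y : ℕ → Fin m → H} (hv : IsApproxSolution A η M f φ₀ φ₁ τ n v y) (hτ : τ ≠ 0)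
    {L : Fin m → H →L[𝕜] H}
    (hL : ∀ j, ∀ x : (A j).domain, L j (((η j / τ ^ 2 : ℝ) : 𝕜) • (x : H) + A j x)
      = ((η j / τ ^ 2 : ℝ) : 𝕜) • (x : H)) {i : ℕ} (hi : i + 2 ≤ n) :
    v (i + 2) = transition L η (v (i + 1) + (v (i + 1) - v i))
      + ((τ ^ 2 : ℝ) : 𝕜) • L 0 (f ((i + 1 : ℕ) * τ) - M (v (i + 1))) := by
  have h1 : 1 ≤ i + 1 := by omega
  rw [hv.average (i + 1) h1 hi, transition_apply]
  have key : ∀ j, η j • y (i + 2) j = (η j : 𝕜) • L j (v (i + 1) + (v (i + 1) - v i))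
      + if j = 0 then ((τ ^ 2 : ℝ) : 𝕜) • L 0 (f ((i + 1 : ℕ) * τ) - M (v (i + 1))) else 0 := by
    intro j
    have h := hv.auxiliary (i + 1) h1 hi j
    rw [RCLike.real_smul_eq_coe_smul (K := 𝕜) (η j), RCLike.real_smul_eq_coe_smul (K := 𝕜),
      show y (i + 1 + 1) j - (2 : ℝ) • v (i + 1) + v (i + 1 - 1)
        = y (i + 1 + 1) j - (v (i + 1) + (v (i + 1) - v i)) by
        rw [two_smul, Nat.add_sub_cancel]; abel] at h
    have := smul_eq_of_resolvent_equation (pow_ne_zero 2 hτ) (hL j)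
      ⟨y (i + 1 + 1) j, hv.mem_domain (i + 1) h1 hi j⟩ h
    rw [RCLike.real_smul_eq_coe_smul (K := 𝕜)]
    refine this.trans ?_
    congr 1
    split_ifs with hj
    · rw [hj]
    · simp
  simp_rw [show i + 1 + 1 = i + 2 from rfl, key]
  rw [Finset.sum_add_distrib]
  simp

/-- The recursion satisfied by the error. -/
theorem error_step {m : ℕ} [NeZero m] {η : Fin m → ℝ} (hsum : ∑ j, η j = 1)
    {L : Fin m → H →L[𝕜] H} {c : 𝕜} {v₀ v₁ v₂ u₀ u₁ u₂ w F g : H} {B₀ B₁ : Fin m → H}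
    (hv : v₂ = transition L η (v₁ + (v₁ - v₀)) + c • L 0 g)
    (h₀ : ∀ j, (η j : 𝕜) • (u₀ - L j u₀) = c • L j (B₀ j))
    (h₁ : ∀ j, (η j : 𝕜) • (u₁ - L j u₁) = c • L j (B₁ j))
    (hF : F = w + ∑ j, B₁ j) :
    v₂ - u₂ = transition L η ((v₁ - u₁) + ((v₁ - u₁) - (v₀ - u₀)))
      + (c • L 0 (g - F) - (u₂ - u₁ - (u₁ - u₀) - c • w)
        - c • ((1 - L 0) F - ∑ j, (1 - L j) (B₁ j) + ∑ j, L j (B₁ j - B₀ j))) := by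
  have hsub : ∀ {x : H} {B : Fin m → H}, (∀ j, (η j : 𝕜) • (x - L j x) = c • L j (B j)) →
      x - transition L η x = c • ∑ j, L j (B j) := by
    intro x B h
    have e : x = ∑ j, (η j : 𝕜) • x := by
      rw [← Finset.sum_smul, ← RCLike.ofReal_sum, hsum, RCLike.ofReal_one, one_smul]
    rw [Finset.smul_sum, transition_apply]
    nth_rewrite 1 [e]
    rw [← Finset.sum_sub_distrib]
    exact Finset.sum_congr rfl fun j _ => by rw [← smul_sub, h]
  have k₀ := hsub h₀
  have k₁ := hsub h₁
  simp only [sub_apply, one_apply_eq_self, Finset.sum_sub_distrib, map_sub, map_add]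
  rw [hv, map_add, map_sub]
  linear_combination (norm := module) k₀ - (2 : 𝕜) • k₁ + c • hF

/-- `A x` for `x ∈ D(A)`, extended by zero. -/
def extendZero (A : H →ₗ.[𝕜] H) (x : H) : H :=
  open scoped Classical in if h : x ∈ A.domain then A ⟨x, h⟩ else 0

theorem extendZero_of_mem {A : H →ₗ.[𝕜] H} {x : H} (h : x ∈ A.domain) :
    extendZero A x = A ⟨x, h⟩ := dif_pos h

/-- The bound for the error increments, before comparison with the constants. -/
theorem norm_err_increment_le [CompleteSpace H] [NormedSpace ℝ H] {m : ℕ} [NeZero m]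
    {A : H →ₗ.[𝕜] H} {Aj : Fin m → H →ₗ.[𝕜] H} {αj : Fin m → ℝ} (hαj : ∀ j, 0 < αj j)
    (hAj : ∀ j, IsSelfAdjointGE (Aj j) (αj j)) (hsum : A = ∑ j, Aj j)
    {η : Fin m → ℝ} (hη : ∀ j, 0 < η j ∧ η j < 1) (hηsum : ∑ j, η j = 1)
    {M : H → H} {a : ℝ} (hM : ∀ x y, ‖M x - M y‖ ≤ a * ‖x - y‖)
    {T : ℝ} (hT : 0 < T) {f : ℝ → H} {φ₀ φ₁ : H} {u : ℝ → H}
    (hu : IsSolution A M f φ₀ φ₁ T u) {n : ℕ} {τ : ℝ} (hτ : 0 < τ) (hn : n * τ = T)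
    {v : ℕ → H} {y : ℕ → Fin m → H} (hv : IsApproxSolution Aj η M f φ₀ φ₁ τ n v y)
    {a' : Fin m → ℝ} (ha' : ∀ j, 0 ≤ a' j)
    (hb : ∀ j, ∀ x ∈ A.domain, ‖extendZero (Aj j) x‖ ≤ a' j * ‖extendZero A x‖)
    {k : ℕ} (hk : k + 1 ≤ n) :
    ‖err τ u v (k + 1) - err τ u v k‖ ≤ ‖err τ u v 1‖
      + ∑ i ∈ Finset.range k, (τ ^ 2 * (a * ‖err τ u v (i + 1)‖)
        + τ * ∫ t in (i * τ)..((i + 2) * τ), J τ (i + 1) t (secondDeriv T u))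
      + τ ^ 2 * (η 0 ^ (-(1 / 2) : ℝ) * ‖f 0 - M φ₀‖ + c₀ η a' * ‖extendZero A φ₀‖)
      + τ ^ 2 * ∑ i ∈ Finset.range k,
        (η 0 ^ (-(1 / 2) : ℝ) * (J τ (i + 1) (i * τ) f + a * J τ (i + 1) (i * τ) u)
          + (c₀ η a' + 1) * (J τ (i + 1) (i * τ) f + a * J τ (i + 1) (i * τ) u
            + J τ (i + 1) (i * τ) (secondDeriv T u))) := by
  choose L hL hLx using fun j =>
    (hAj j).exists_resolvent (hαj j) (div_pos (hη j).1 (pow_pos hτ 2))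
  have hmem : ∀ i ≤ n, (i * τ : ℝ) ∈ Icc 0 T := fun i hi =>
    ⟨by positivity, hn ▸ mul_le_mul_of_nonneg_right (by exact_mod_cast hi) hτ.le⟩
  have hUA : ∀ i ≤ n, u (i * τ) ∈ A.domain := fun i hi => hu.mem_domain ⟨_, hmem i hi⟩
  have hdom : ∀ x ∈ A.domain, ∀ j, x ∈ (Aj j).domain := fun x hx j => by
    rw [hsum, mem_domain_sum] at hx
    exact hx j (Finset.mem_univ j)
  have hAsum : ∀ x ∈ A.domain, extendZero A x = ∑ j, extendZero (Aj j) x := fun x hx => by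
    rw [extendZero_of_mem hx]
    subst hsum
    exact sum_apply_of_mem _ _ _ hx fun j _ h => (extendZero_of_mem h).symm
  have hAsub : ∀ x ∈ A.domain, ∀ x' ∈ A.domain, ∀ j,
      extendZero (Aj j) x - extendZero (Aj j) x' = extendZero (Aj j) (x - x') := by
    intro x hx x' hx' j
    have h := hdom x hx j
    have h' := hdom x' hx' j
    rw [extendZero_of_mem h, extendZero_of_mem h', extendZero_of_mem ((Aj j).domain.sub_mem h h'),
      ← LinearPMap.map_sub]
    rfl
  let B : ℕ → Fin m → H := fun i j => extendZero (Aj j) (u (i * τ))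
  let F : ℕ → H := fun i => f (i * τ) - M (u (i * τ))
  let e : ℕ → H := fun i => ((τ ^ 2 : ℝ) : 𝕜) •
      L 0 (f ((i + 1 : ℕ) * τ) - M (v (i + 1)) - F (i + 1))
    - (u ((i + 2 : ℕ) * τ) - u ((i + 1 : ℕ) * τ) - (u ((i + 1 : ℕ) * τ) - u (i * τ))
      - ((τ ^ 2 : ℝ) : 𝕜) • secondDeriv T u ((i + 1 : ℕ) * τ))
  have hF : ∀ i ≤ n, F i = secondDeriv T u (i * τ) + ∑ j, B i j := fun i hi => by
    have h := hu.equation ⟨_, hmem i hi⟩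
    simp only at h
    rw [← hAsum _ (hUA i hi), extendZero_of_mem (hUA i hi)]
    simp only [F]
    rw [← h]
    abel
  have hB : ∀ i ≤ n, ∀ j, (η j : 𝕜) • (u (i * τ) - L j (u (i * τ)))
      = ((τ ^ 2 : ℝ) : 𝕜) • L j (B i j) := fun i hi j => by
    have h := hdom _ (hUA i hi) j
    simp only [B]
    rw [extendZero_of_mem h]
    exact smul_one_sub_resolvent (pow_ne_zero 2 hτ.ne') (hLx j) ⟨_, h⟩
  have hrec : ∀ i < k, err τ u v (i + 2)
      = transition L η (err τ u v (i + 1) + (err τ u v (i + 1) - err τ u v i)) + (e i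
        - ((τ ^ 2 : ℝ) : 𝕜) • ((1 - L 0) (F (i + 1)) - ∑ j, (1 - L j) (B (i + 1) j)
          + ∑ j, L j (B (i + 1) j - B i j))) := fun i hi =>
    error_step hηsum (hv.step hτ.ne' hLx (by omega)) (hB i (by omega)) (hB (i + 1) (by omega))
      (hF (i + 1) (by omega))
  have h0 : err τ u v 0 = 0 := by
    simp [err, hv.start_zero, hu.initial]
  have main := norm_increment_le hL hη hηsum (sq_nonneg τ) h0 k hrec
  have hrp : ∀ j, 0 ≤ η j ^ (-(1 / 2) : ℝ) := fun j => Real.rpow_nonneg (hη j).1.le _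
  have b1 : ∀ i ∈ Finset.range k, ‖e i‖ ≤ τ ^ 2 * (a * ‖err τ u v (i + 1)‖)
      + τ * ∫ t in (i * τ)..((i + 2) * τ), J τ (i + 1) t (secondDeriv T u) := by
    intro i hi
    have hi' := Finset.mem_range.1 hi
    refine (norm_sub_le _ _).trans (add_le_add ?_ ?_)
    · rw [norm_smul, RCLike.norm_ofReal, abs_of_nonneg (sq_nonneg τ)]
      refine mul_le_mul_of_nonneg_left (((hL 0).norm_apply_le _).trans ?_) (sq_nonneg τ)
      have : f ((i + 1 : ℕ) * τ) - M (v (i + 1)) - F (i + 1)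
          = -(M (v (i + 1)) - M (u ((i + 1 : ℕ) * τ))) := by
        simp only [F]; abel
      rw [this, norm_neg]
      exact hM _ _
    · have hT2 := norm_second_difference_le hT hu.contDiffOn (s := (i + 1 : ℕ) * τ) hτ.le
        (by push_cast; nlinarith [(Nat.cast_nonneg i : (0 : ℝ) ≤ i)])
        (by
          have := (hmem (i + 2) (by omega)).2
          push_cast at this ⊢
          linarith)
      rw [show ((i + 1 : ℕ) : ℝ) * τ + τ = (i + 2 : ℕ) * τ by push_cast; ring,
        show ((i + 1 : ℕ) : ℝ) * τ - τ = i * τ by push_cast; ring,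
        RCLike.real_smul_eq_coe_smul (K := 𝕜)] at hT2
      refine hT2.trans (le_of_eq ?_)
      rw [show (((i + 2 : ℕ) : ℝ)) = (i : ℝ) + 2 by push_cast; ring]
      rfl
  have b2 : η 0 ^ (-(1 / 2) : ℝ) * ‖F 0‖ + ∑ j, η j ^ (-(1 / 2) : ℝ) * ‖B 0 j‖
      ≤ η 0 ^ (-(1 / 2) : ℝ) * ‖f 0 - M φ₀‖ + c₀ η a' * ‖extendZero A φ₀‖ := by
    have hU0 : u ((0 : ℕ) * τ) = φ₀ := by simp [hu.initial]
    refine add_le_add (le_of_eq ?_) ?_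
    · simp only [F]
      rw [hU0]
      simp
    · rw [c₀, Finset.sum_mul]
      refine Finset.sum_le_sum fun j _ => ?_
      rw [mul_assoc]
      refine mul_le_mul_of_nonneg_left ?_ (hrp j)
      simp only [B]
      have := hb j _ (hUA 0 (by omega))
      rwa [hU0] at this ⊢
  have b3 : ∀ i ∈ Finset.range k, η 0 ^ (-(1 / 2) : ℝ) * ‖F (i + 1) - F i‖
      + ∑ j, η j ^ (-(1 / 2) : ℝ) * ‖B (i + 1) j - B i j‖ + ‖∑ j, (B (i + 1) j - B i j)‖
      ≤ η 0 ^ (-(1 / 2) : ℝ) * (J τ (i + 1) (i * τ) f + a * J τ (i + 1) (i * τ) u)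
          + (c₀ η a' + 1) * (J τ (i + 1) (i * τ) f + a * J τ (i + 1) (i * τ) u
            + J τ (i + 1) (i * τ) (secondDeriv T u)) := by
    intro i hi
    have hi' := Finset.mem_range.1 hi
    have hm1 := hUA (i + 1) (by omega)
    have hm0 := hUA i (by omega)
    have hms := A.domain.sub_mem hm1 hm0
    have hdF : ‖F (i + 1) - F i‖ ≤ J τ (i + 1) (i * τ) f + a * J τ (i + 1) (i * τ) u := by
      have : F (i + 1) - F i = (f ((i + 1 : ℕ) * τ) - f (i * τ))
          - (M (u ((i + 1 : ℕ) * τ)) - M (u (i * τ))) := by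
        simp only [F]; abel
      rw [this]
      exact (norm_sub_le _ _).trans (add_le_add le_rfl (hM _ _))
    have hdB : ∑ j, (B (i + 1) j - B i j)
        = extendZero A (u ((i + 1 : ℕ) * τ) - u (i * τ)) := by
      rw [hAsum _ hms]
      exact Finset.sum_congr rfl fun j _ => hAsub _ hm1 _ hm0 j
    -- The equation gives $A\Delta u=\Delta F-\Delta u''$, so no regularity of $Au$ enters the
    -- bound.
    have hdA : ‖extendZero A (u ((i + 1 : ℕ) * τ) - u (i * τ))‖
        ≤ J τ (i + 1) (i * τ) f + a * J τ (i + 1) (i * τ) u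
          + J τ (i + 1) (i * τ) (secondDeriv T u) := by
      have : extendZero A (u ((i + 1 : ℕ) * τ) - u (i * τ)) = (F (i + 1) - F i)
          - (secondDeriv T u ((i + 1 : ℕ) * τ) - secondDeriv T u (i * τ)) := by
        rw [← hdB, hF (i + 1) (by omega), hF i (by omega), Finset.sum_sub_distrib]
        abel
      rw [this]
      exact (norm_sub_le _ _).trans (add_le_add hdF le_rfl)
    have hdc : ∑ j, η j ^ (-(1 / 2) : ℝ) * ‖B (i + 1) j - B i j‖
        ≤ c₀ η a' * ‖extendZero A (u ((i + 1 : ℕ) * τ) - u (i * τ))‖ := by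
      rw [c₀, Finset.sum_mul]
      refine Finset.sum_le_sum fun j _ => ?_
      rw [mul_assoc]
      refine mul_le_mul_of_nonneg_left ?_ (hrp j)
      rw [hAsub _ hm1 _ hm0 j]
      exact hb j _ hms
    have hc₀ : 0 ≤ c₀ η a' + 1 := add_nonneg (c₀_nonneg hη ha') zero_le_one
    rw [hdB, add_assoc]
    refine add_le_add (mul_le_mul_of_nonneg_left hdF (hrp 0)) ?_
    refine le_trans ?_ (mul_le_mul_of_nonneg_left hdA hc₀)
    linarith
  have b4 := Finset.sum_le_sum b1
  have b5 := mul_le_mul_of_nonneg_left b2 (sq_nonneg τ)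
  have b6 := mul_le_mul_of_nonneg_left (Finset.sum_le_sum b3) (sq_nonneg τ)
  linarith

end Scheme

end HypScheme

/-! ### The error estimate -/

theorem theorem6p1 {𝕜 : Type*} [RCLike 𝕜] {H : Type*} [NormedAddCommGroup H]
    [InnerProductSpace 𝕜 H] [NormedSpace ℝ H] [CompleteSpace H]
    {m : ℕ} [NeZero m]
    (A : H →ₗ.[𝕜] H) (α : ℝ) (hα : 0 < α) (hA : HypScheme.IsSelfAdjointGE A α)
    (Aj : Fin m → H →ₗ.[𝕜] H) (αj : Fin m → ℝ) (hαj : ∀ j, 0 < αj j)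
    (hAj : ∀ j, HypScheme.IsSelfAdjointGE (Aj j) (αj j))
    (hsum : A = ∑ j, Aj j)
    (η : Fin m → ℝ) (hη : ∀ j, 0 < η j ∧ η j < 1) (hηsum : ∑ j, η j = 1)
    (M : H → H) (a : ℝ) (ha : 0 < a) (hM : ∀ x y, ‖M x - M y‖ ≤ a * ‖x - y‖)
    (T : ℝ) (hT : 0 < T) (f : ℝ → H) (hf : ContinuousOn f (Set.Icc 0 T))
    (φ₀ φ₁ : H) (hφ₀ : φ₀ ∈ A.domain)
    (u : ℝ → H) (hu : HypScheme.IsSolution A M f φ₀ φ₁ T u)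
    (n : ℕ) (hn : 1 < n) (τ : ℝ) (hτ : τ = T / n)
    (v : ℕ → H) (y : ℕ → Fin m → H)
    (hv : HypScheme.IsApproxSolution Aj η M f φ₀ φ₁ τ n v y)
    (a' : Fin m → ℝ) (ha' : ∀ j, a' j = HypScheme.opNorm (HypScheme.prod (Aj j) A.inverse)) :
    (∀ j, HypScheme.IsBddEverywhere (HypScheme.prod (Aj j) A.inverse)) ∧
    ∀ s : ℝ, s = -1 ∨ s = 1 → ∀ k : ℕ, 1 ≤ k → k + 1 ≤ n →
      ‖τ⁻¹ • (HypScheme.err τ u v (k + 1) - HypScheme.err τ u v k)‖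
        ≤ ‖τ⁻¹ • (HypScheme.err τ u v 1 - HypScheme.err τ u v 0)‖
          + (τ * (k * τ)) ^ (-(1 / 2) : ℝ) * ‖HypScheme.err τ u v 0‖
          + HypScheme.thetaTilde η a' a τ u (HypScheme.secondDeriv T u) f v
              (A ⟨φ₀, hφ₀⟩) (M φ₀) s k := by
  have hτ0 : 0 < τ := by
    rw [hτ]
    exact div_pos hT (by exact_mod_cast (by omega : 0 < n))
  have hnτ : n * τ = T := by
    rw [hτ]
    field_simp
  have hle : ∀ j, A.domain ≤ (Aj j).domain := fun j x hx => by
    rw [hsum, HypScheme.mem_domain_sum] at hx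
    exact hx j (Finset.mem_univ j)
  have hbdd := fun j => hA.isBddEverywhere_prod_inverse hα (hAj j).selfAdjoint.isClosed (hle j)
  refine ⟨fun j => (hbdd j).1, fun s _ k hk1 hkn => ?_⟩
  have ha0 : ∀ j, 0 ≤ a' j := fun j => by
    rw [ha']
    exact HypScheme.opNorm_nonneg _
  have hb : ∀ j, ∀ x ∈ A.domain,
      ‖HypScheme.extendZero (Aj j) x‖ ≤ a' j * ‖HypScheme.extendZero A x‖ := fun j x hx => by
    rw [HypScheme.extendZero_of_mem hx, HypScheme.extendZero_of_mem (hle j hx), ha']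
    exact (hbdd j).2 ⟨x, hx⟩
  have h := HypScheme.norm_err_increment_le hαj hAj hsum hη hηsum hM hT hu hτ0 hnτ hv ha0 hb hkn
  rw [HypScheme.extendZero_of_mem hφ₀] at h
  have h0 : HypScheme.err τ u v 0 = 0 := by
    simp [HypScheme.err, hv.start_zero, hu.initial]
  have h01 := HypScheme.c₀_add_one_le_c₁ hη ha0
  have h05 := HypScheme.c₀_add_one_le_c₅ hη ha0
  have h06 := HypScheme.c₀_add_one_add_le_c₆ η a'
  have h67 := HypScheme.c₆_le_c₇ hη ha0
  have h00 := HypScheme.c₀_nonneg hη ha0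
  have hr0 : 0 ≤ η 0 ^ (-(1 / 2) : ℝ) := Real.rpow_nonneg (hη 0).1.le _
  -- The $z_0$ term vanishes because $v_0=u(0)=\varphi_0$; the inequality is then multiplied by
  -- $\tau$.
  rw [h0, sub_zero, norm_zero, mul_zero, add_zero, norm_smul, norm_smul,
    Real.norm_of_nonneg (inv_nonneg.2 hτ0.le), inv_mul_le_iff₀ hτ0, mul_add,
    mul_inv_cancel_left₀ hτ0.ne']
  refine h.trans ?_
  rw [add_assoc, add_assoc]
  refine add_le_add le_rfl ?_
  rw [HypScheme.thetaTilde, HypScheme.sum_Icc_one_eq_sum_range,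
    HypScheme.sum_Icc_one_eq_sum_range, HypScheme.sum_Icc_one_eq_sum_range]
  have hinit : τ ^ 2 * (η 0 ^ (-(1 / 2) : ℝ) * ‖f 0 - M φ₀‖
        + HypScheme.c₀ η a' * ‖A ⟨φ₀, hφ₀⟩‖)
      ≤ τ * (τ * (HypScheme.c₁ η a' * ‖A ⟨φ₀, hφ₀⟩‖
        + HypScheme.c₆ η a' * (‖f 0‖ + ‖M φ₀‖))) := by
    rw [← mul_assoc, ← pow_two]
    refine mul_le_mul_of_nonneg_left ?_ (sq_nonneg τ)
    rw [add_comm]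
    refine add_le_add (mul_le_mul_of_nonneg_right (by linarith) (norm_nonneg _)) ?_
    exact mul_le_mul (by linarith) (norm_sub_le _ _) (norm_nonneg _) (by linarith)
  have hsplit : ∀ X Y p q r : ℕ → ℝ,
      (∀ i, X i + τ ^ 2 * Y i ≤ τ * (τ * p i + τ * q i + r i)) →
      ∑ i ∈ Finset.range k, X i + τ ^ 2 * ∑ i ∈ Finset.range k, Y i
        ≤ τ * (τ * ∑ i ∈ Finset.range k, p i + τ * ∑ i ∈ Finset.range k, q i
          + ∑ i ∈ Finset.range k, r i) := by
    intro X Y p q r hXY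
    have := Finset.sum_le_sum fun i (_ : i ∈ Finset.range k) => hXY i
    simpa only [Finset.sum_add_distrib, ← Finset.mul_sum] using this
  rw [add_left_comm, mul_add τ (_ + _ + _)]
  refine le_trans (add_le_add hinit (hsplit _ _ _ _ _ fun i => ?_)) (le_of_eq (add_comm _ _))
  rw [show ((i + 1 : ℕ) : ℝ) - 1 = i by push_cast; ring,
    show ((i + 1 : ℕ) : ℝ) + 1 = i + 2 by push_cast; ring]
  have hJ : ∀ t (w : ℝ → H), 0 ≤ HypScheme.J τ (i + 1) t w := fun t w => norm_nonneg _
  have j1 := hJ (i * τ) f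
  have j2 := hJ (i * τ) u
  have j3 := hJ (i * τ) (HypScheme.secondDeriv T u)
  have j4 := hJ ((i + 2) * τ) (HypScheme.secondDeriv T u)
  have j5 := hJ ((((i + 1 : ℕ) : ℝ) + s) * τ) f
  set x₁ := HypScheme.J τ (i + 1) (i * τ) f
  set x₂ := HypScheme.J τ (i + 1) (i * τ) u
  set x₃ := HypScheme.J τ (i + 1) (i * τ) (HypScheme.secondDeriv T u)
  have k1 : (HypScheme.c₀ η a' + 1 + η 0 ^ (-(1 / 2) : ℝ)) * x₁ ≤ HypScheme.c₇ η a' * x₁ :=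
    mul_le_mul_of_nonneg_right (h06.trans h67) j1
  have k2 : (HypScheme.c₀ η a' + 1 + η 0 ^ (-(1 / 2) : ℝ)) * (a * x₂)
      ≤ HypScheme.c₆ η a' * (a * x₂) :=
    mul_le_mul_of_nonneg_right h06 (mul_nonneg ha.le j2)
  have k3 : (HypScheme.c₀ η a' + 1) * x₃ ≤ HypScheme.c₅ η a' * x₃ :=
    mul_le_mul_of_nonneg_right h05 j3
  -- The terms $J_i(t_{i+1},u'')$ and $J_i(t_{i+s},f)$ on the right are only used as nonnegative
  -- quantities, so both choices of $s$ are covered at once.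
  have k4 : η 0 ^ (-(1 / 2) : ℝ) * (x₁ + a * x₂) + (HypScheme.c₀ η a' + 1) * (x₁ + a * x₂ + x₃)
      ≤ (HypScheme.c₅ η a' * x₃ + HypScheme.J τ (i + 1) ((i + 2) * τ) (HypScheme.secondDeriv T u)
          + a * HypScheme.c₆ η a' * x₂)
        + (HypScheme.c₇ η a' * x₁ + HypScheme.J τ (i + 1) ((((i + 1 : ℕ) : ℝ) + s) * τ) f) := by
    linarith
  have k5 := mul_le_mul_of_nonneg_left k4 (sq_nonneg τ)
  linarith

end
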